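/- For a finite group $G$ let $D(G)$ be its Drinfel'd double over $\mathbb{C}$: the Hopf algebra with basis $e_g\otimes x$ ($g,x\in G$), product $(e_g\otimes x)(e_h\otimes y)=\delta_{g,xhx^{-1}}\,e_g\otimes xy$, coproduct $\Delta(e_g\otimes x)=\sum_{ab=g}(e_a\otimes x)\otimes(e_b\otimes x)$, counit $\varepsilon(e_g\otimes x)=\delta_{g,1}$, and normalized integral $\Lambda=|G|^{-1}\sum_{x\in G} e_1\otimes x$. For a finite-dimensional representation $V$ of $D(G)$ with character $\chi$ and $n\ge 1$, the $n$-th Frobenius-Schur indicator is $\nu_n(V)=\chi(\Lambda^{[n]})$, where $h^{[n]}=h_1h_2\cdots h_n$ in Sweedler notation. $G$ is $FSZ_n$ if $\nu_n(V)\in\mathbb{Z}$ for every irreducible $V$, and $FSZ$ if it is $FSZ_n$ for all $n\ge 1$. A $p$-group is regular if for all $a,b$ and every power $q$ of $p$ one has $(ab)^q=a^qb^qc_1^q\cdots c_t^q$ with all $c_i$ in the commutator subgroup of $\langle a,b\rangle$, and irregular otherwise. For $a,b,x,y,w\in\mathbb{Z}/5$ let $M(a,b,x,y,w)$ be the group with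 generators $s_0,\dots,s_5$ and relations $$s_0^5=s_5^a,\quad s_1^5=s_5^b,\quad s_2^5=s_3^5=s_4^5=s_5^5=1,\quad s_is_0=s_0s_is_{i+1}\ (1\le i\le 4),$$ $$s_2s_1=s_1s_2s_4^xs_5^y,\quad s_3s_1=s_1s_3s_5^{x+w},\quad s_4s_1=s_1s_4s_5^w,\quad s_3s_2=s_2s_3s_5^{-w},$$ $$s_4s_2=s_2s_4,\quad s_4s_3=s_3s_4,\quad s_5\ \text{central}.$$ 1. If $w\ne 0$, or if $b\neq 0$ and $(a,b)\ne(0,-1)$, then $M(a,b,x,y,w)$ is an irregular $5$-group of order $5^6=15625$ and exponent $25$, and some indicator $\nu_5(V)$ of an irreducible representation $V$ of $D(M(a,b,x,y,w))$ is not an integer. (Up to isomorphism these are the $32$ non-$FSZ$ groups of order $5^6$ of the GAP library, $\mathrm{SmallGroup}(15625,668)$ being one of them; this identification with library entries only explains the choice of the groups and is not part of the assertion.) 2. If $G$ is any group of order $5^6$ and exponent $25$ and $V$ is an irreducible representation of $D(G)$ for which $\nu_5(V)$ is not an integer, then $\nu_5(V)$ is an algebraic integer in $\mathbb{Q}(\sqrt5)\setminus\mathbb{Q}$.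 3. If a finite group $F$ is not $FSZ$, then $F\times H$ is not $FSZ$ for every finite group $H$. There are infinitely many non-$FSZ$ finite groups, up to isomorphism; indeed, infinitely many integers occur as orders of non-$FSZ$ groups. -/

import Mathlib

open scoped TensorProduct

universe u

/-! ### The quantum double of a finite group -/

/-- The quantum (Drinfel'd) double `D(G)` of a finite group `G` over `ℂ`, as a vector space with
basis the symbols `e_g ⊗ x`, `g, x ∈ G`. Here `e_g` is the indicator function of `g` in the
function algebra `ℂ^G`, and `x` is in the group algebra `ℂ G`. -/
def DrinfeldDouble (G : Type u) : Type u := G × G →₀ ℂ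

namespace DrinfeldDouble

noncomputable section

instance (G : Type u) : AddCommGroup (DrinfeldDouble G) :=
  inferInstanceAs (AddCommGroup (G × G →₀ ℂ))

instance (G : Type u) : Module ℂ (DrinfeldDouble G) :=
  inferInstanceAs (Module ℂ (G × G →₀ ℂ))

variable {G : Type u}

/-- The basis element `e_g ⊗ x` of `D(G)`. -/
def elt (g x : G) : DrinfeldDouble G := Finsupp.single (g, x) (1 : ℂ)

/-- The linear map out of `D(G)` with prescribed values on the basis elements `e_g ⊗ x`. -/
def lift {M : Type*} [AddCommGroup M] [Module ℂ M] (f : G → G → M) : DrinfeldDouble G →ₗ[ℂ] M :=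
  Finsupp.linearCombination ℂ (fun p : G × G => f p.1 p.2)

@[simp] theorem lift_elt {M : Type*} [AddCommGroup M] [Module ℂ M] (f : G → G → M) (g x : G) :
    lift f (elt g x) = f g x := by
  unfold lift elt
  exact (Finsupp.linearCombination_single ℂ (1 : ℂ) (g, x)).trans (one_smul ℂ _)

theorem induction {P : DrinfeldDouble G → Prop} (h : DrinfeldDouble G) (h0 : P 0)
    (hadd : ∀ a b, P a → P b → P (a + b)) (hs : ∀ (c : ℂ) g x, P (c • elt g x)) : P h := by
  refine Finsupp.induction_linear (motive := P) h h0 hadd ?_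
  rintro ⟨g, x⟩ c
  have := hs c g x
  unfold elt at this
  have e : c • (Finsupp.single (g, x) (1 : ℂ) : G × G →₀ ℂ) = Finsupp.single (g, x) c := by
    rw [Finsupp.smul_single, smul_eq_mul, mul_one]
  exact e ▸ this

theorem lin_ext {M : Type*} [AddCommGroup M] [Module ℂ M] {φ ψ : DrinfeldDouble G →ₗ[ℂ] M}
    (h : ∀ g x, φ (elt g x) = ψ (elt g x)) : φ = ψ := by
  ext a
  induction a using induction with
  | h0 => simp
  | hadd a b ha hb => rw [map_add, map_add, ha, hb]
  | hs c g x => rw [map_smul, map_smul, h]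

variable [Group G]

open Classical in
/-- The multiplication of `D(G)`:
`(e_g ⊗ x) (e_h ⊗ y) = e_g ⊗ x y` if `g = x h x⁻¹`, and `0` otherwise. -/
def mulHom : DrinfeldDouble G →ₗ[ℂ] DrinfeldDouble G →ₗ[ℂ] DrinfeldDouble G :=
  lift fun g x => lift fun h y => if g = x * h * x⁻¹ then elt g (x * y) else 0

instance : Mul (DrinfeldDouble G) := ⟨fun a b => mulHom a b⟩

theorem mul_def (a b : DrinfeldDouble G) : a * b = mulHom a b := rfl

open Classical in
theorem elt_mul_elt (g x h y : G) :
    elt g x * elt h y = if g = x * h * x⁻¹ then elt g (x * y) else 0 := by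
  rw [mul_def]; unfold mulHom; rw [lift_elt, lift_elt]

variable [Fintype G]

/-- The unit of `D(G)` is `∑_g e_g ⊗ 1`. -/
instance : One (DrinfeldDouble G) := ⟨∑ g : G, elt g 1⟩

theorem one_def : (1 : DrinfeldDouble G) = ∑ g : G, elt g 1 := rfl

instance : Ring (DrinfeldDouble G) :=
  { (inferInstance : AddCommGroup (DrinfeldDouble G)),
    (inferInstance : Mul (DrinfeldDouble G)),
    (inferInstance : One (DrinfeldDouble G)) with
    left_distrib := fun a b c => by simp only [mul_def, map_add]
    right_distrib := fun a b c => by simp only [mul_def, map_add, LinearMap.add_apply]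
    zero_mul := fun a => by simp only [mul_def, map_zero, LinearMap.zero_apply]
    mul_zero := fun a => by simp only [mul_def, map_zero]
    mul_assoc := fun a b c => by
      induction a using induction with
      | h0 => simp only [mul_def, map_zero, LinearMap.zero_apply]
      | hadd a a' ha ha' =>
        simp only [mul_def, map_add, LinearMap.add_apply] at *
        rw [ha, ha']
      | hs r g x =>
      induction b using induction with
      | h0 => simp only [mul_def, map_zero, LinearMap.zero_apply]
      | hadd b b' hb hb' =>
        simp only [mul_def, map_add, LinearMap.add_apply] at *
        rw [hb, hb']
      | hs s h y =>
      induction c using induction with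
      | h0 => simp only [mul_def, map_zero]
      | hadd c c' hc hc' =>
        simp only [mul_def, map_add] at *
        rw [hc, hc']
      | hs t k z =>
        have key : elt g x * elt h y * elt k z = elt g x * (elt h y * elt k z) := by
          rw [elt_mul_elt, elt_mul_elt h y]
          by_cases h1 : g = x * h * x⁻¹
          · by_cases h2 : h = y * k * y⁻¹
            · have h3 : g = x * y * k * (x * y)⁻¹ := by rw [h1, h2]; group
              rw [if_pos h1, if_pos h2, elt_mul_elt, elt_mul_elt, if_pos h1, if_pos h3, mul_assoc]
            · have h3 : ¬ g = x * y * k * (x * y)⁻¹ := by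
                intro h3
                apply h2
                have : x * h * x⁻¹ = x * (y * k * y⁻¹) * x⁻¹ := by rw [← h1, h3]; group
                simpa using this
              rw [if_pos h1, if_neg h2, elt_mul_elt, if_neg h3]
              simp only [mul_def, map_zero]
          · rw [if_neg h1]
            by_cases h2 : h = y * k * y⁻¹
            · rw [if_pos h2, elt_mul_elt, if_neg h1]
              simp only [mul_def, map_zero, LinearMap.zero_apply]
            · rw [if_neg h2]
              simp only [mul_def, map_zero, LinearMap.zero_apply]
        simp only [mul_def, map_smul, LinearMap.smul_apply] at *
        rw [key]
    one_mul := fun a => by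
      induction a using induction with
      | h0 => simp only [mul_def, map_zero]
      | hadd a b ha hb =>
        simp only [mul_def, map_add] at *
        rw [ha, hb]
      | hs c h y =>
        have : (1 : DrinfeldDouble G) * elt h y = elt h y := by
          rw [mul_def, one_def, map_sum, LinearMap.sum_apply]
          simp only [← mul_def, elt_mul_elt]
          rw [Finset.sum_eq_single h]
          · rw [if_pos (by group), one_mul]
          · intro g _ hg
            rw [if_neg]
            rintro rfl
            apply hg
            group
          · intro hh
            exact absurd (Finset.mem_univ h) hh
        simp only [mul_def, map_smul] at *
        rw [this]
    mul_one := fun a => by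
      induction a using induction with
      | h0 => simp only [mul_def, map_zero, LinearMap.zero_apply]
      | hadd a b ha hb =>
        simp only [mul_def, map_add, LinearMap.add_apply] at *
        rw [ha, hb]
      | hs c h y =>
        have : elt h y * (1 : DrinfeldDouble G) = elt h y := by
          rw [mul_def, one_def, map_sum]
          simp only [← mul_def, elt_mul_elt]
          rw [Finset.sum_eq_single (y⁻¹ * h * y)]
          · rw [if_pos (by group), mul_one]
          · intro g _ hg
            rw [if_neg]
            rintro rfl
            apply hg
            group
          · intro hh
            exact absurd (Finset.mem_univ _) hh
        simp only [mul_def, map_smul, LinearMap.smul_apply] at *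
        rw [this] }

instance : Algebra ℂ (DrinfeldDouble G) :=
  Algebra.ofModule (fun r a b => by simp only [mul_def, map_smul, LinearMap.smul_apply])
    (fun r a b => by simp only [mul_def, map_smul])

/-- The comultiplication `Δ(e_g ⊗ x) = ∑_{a b = g} (e_a ⊗ x) ⊗ (e_b ⊗ x)` and the counit
`ε(e_g ⊗ x) = δ_{g, 1}` of `D(G)`. -/
instance : CoalgebraStruct ℂ (DrinfeldDouble G) where
  comul := lift fun g x => ∑ a : G, elt a x ⊗ₜ[ℂ] elt (a⁻¹ * g) x
  counit := by
    classical
    exact lift fun g _ => if g = 1 then 1 else 0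

theorem comul_elt (g x : G) :
    Coalgebra.comul (R := ℂ) (elt g x) = ∑ a : G, elt a x ⊗ₜ[ℂ] elt (a⁻¹ * g) x :=
  lift_elt _ g x

open Classical in
theorem counit_elt (g x : G) :
    Coalgebra.counit (R := ℂ) (elt g x) = if g = 1 then 1 else 0 := by
  refine (lift_elt _ g x).trans ?_
  congr

instance : Coalgebra ℂ (DrinfeldDouble G) where
  coassoc := by
    refine lin_ext fun g x => ?_
    simp only [LinearMap.comp_apply, comul_elt, map_sum, LinearMap.rTensor_tmul,
      LinearMap.lTensor_tmul, TensorProduct.sum_tmul, TensorProduct.tmul_sum,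
      LinearEquiv.coe_coe, TensorProduct.assoc_tmul]
    rw [Finset.sum_comm]
    refine Finset.sum_congr rfl fun a _ => ?_
    refine Fintype.sum_equiv (Equiv.mulLeft a⁻¹) _ _ fun b => ?_
    simp [mul_assoc]
  rTensor_counit_comp_comul := by
    refine lin_ext fun g x => ?_
    simp only [LinearMap.comp_apply, comul_elt, map_sum, LinearMap.rTensor_tmul, counit_elt]
    rw [Finset.sum_eq_single 1]
    · simp
    · intro b _ hb; simp [hb]
    · simp
  lTensor_counit_comp_comul := by
    refine lin_ext fun g x => ?_
    simp only [LinearMap.comp_apply, comul_elt, map_sum, LinearMap.lTensor_tmul, counit_elt]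
    rw [Finset.sum_eq_single g]
    · simp
    · intro b _ hb
      have : ¬ b⁻¹ * g = 1 := by rw [inv_mul_eq_one]; exact hb
      simp [this]
    · simp

theorem lin_ext₂ {M : Type*} [AddCommGroup M] [Module ℂ M]
    {φ ψ : DrinfeldDouble G →ₗ[ℂ] DrinfeldDouble G →ₗ[ℂ] M}
    (h : ∀ g x k y, φ (elt g x) (elt k y) = ψ (elt g x) (elt k y)) : φ = ψ :=
  lin_ext fun g x => lin_ext fun k y => h g x k y

instance : Bialgebra ℂ (DrinfeldDouble G) where
  counit_one := by
    classical
    rw [one_def, map_sum]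
    simp [counit_elt]
  comul_one := by
    rw [one_def, map_sum, Algebra.TensorProduct.one_def, one_def]
    simp only [comul_elt, TensorProduct.sum_tmul, TensorProduct.tmul_sum]
    rw [Finset.sum_comm]
    conv_rhs => rw [Finset.sum_comm]
    refine Finset.sum_congr rfl fun a _ => ?_
    exact Fintype.sum_equiv (Equiv.mulLeft a⁻¹) _ _ fun b => by simp
  mul_compr₂_counit := by
    classical
    refine lin_ext₂ fun g x h y => ?_
    simp only [LinearMap.compr₂_apply, LinearMap.compl₁₂_apply, LinearMap.mul_apply',
      elt_mul_elt, counit_elt]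
    by_cases hh : h = 1
    · subst hh
      by_cases hg : g = 1 <;> simp [hg, counit_elt]
    · by_cases hg : g = 1
      · have : ¬ (1 : G) = x * h * x⁻¹ := by
          intro e
          apply hh
          have : x⁻¹ * 1 * x = h := by rw [e]; group
          simpa using this.symm
        simp [hg, hh, this]
      · split_ifs <;> simp [counit_elt, hg]
  mul_compr₂_comul := by
    classical
    refine lin_ext₂ fun g x h y => ?_
    simp only [LinearMap.compr₂_apply, LinearMap.compl₁₂_apply, LinearMap.mul_apply',
      elt_mul_elt, comul_elt, Finset.sum_mul_sum, Algebra.TensorProduct.tmul_mul_tmul]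
    have inner : ∀ a : G,
        (∑ b : G, (if a = x * b * x⁻¹ then elt a (x * y) else 0) ⊗ₜ[ℂ]
          (if a⁻¹ * g = x * (b⁻¹ * h) * x⁻¹ then elt (a⁻¹ * g) (x * y) else 0))
          = if g = x * h * x⁻¹ then
              (elt a (x * y) : DrinfeldDouble G) ⊗ₜ[ℂ] elt (a⁻¹ * g) (x * y) else 0 := by
      intro a
      rw [Finset.sum_eq_single (x⁻¹ * a * x)]
      · have e1 : a = x * (x⁻¹ * a * x) * x⁻¹ := by group
        have e2 : (a⁻¹ * g = x * ((x⁻¹ * a * x)⁻¹ * h) * x⁻¹) ↔ g = x * h * x⁻¹ := by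
          have : x * ((x⁻¹ * a * x)⁻¹ * h) * x⁻¹ = a⁻¹ * (x * h * x⁻¹) := by group
          rw [this, mul_right_inj]
        rw [if_pos e1]
        by_cases hg : g = x * h * x⁻¹
        · rw [if_pos (e2.2 hg), if_pos hg]
        · rw [if_neg (fun h' => hg (e2.1 h')), if_neg hg, TensorProduct.tmul_zero]
      · intro b _ hb
        have : ¬ a = x * b * x⁻¹ := by
          rintro rfl
          apply hb
          group
        rw [if_neg this, TensorProduct.zero_tmul]
      · simp
    rw [Finset.sum_congr rfl fun a _ => inner a]
    by_cases hg : g = x * h * x⁻¹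
    · simp only [if_pos hg, comul_elt]
    · simp [if_neg hg]

/-- The antipode of `D(G)` is `S(e_g ⊗ x) = e_{x⁻¹ g⁻¹ x} ⊗ x⁻¹`. -/
instance : HopfAlgebra ℂ (DrinfeldDouble G) where
  antipode := lift fun g x => elt (x⁻¹ * g⁻¹ * x) x⁻¹
  mul_antipode_rTensor_comul := by
    classical
    refine lin_ext fun g x => ?_
    simp only [LinearMap.comp_apply, comul_elt, map_sum, LinearMap.rTensor_tmul, counit_elt,
      lift_elt, LinearMap.mul'_apply, elt_mul_elt, Algebra.linearMap_apply]
    have e : ∀ a : G, (x⁻¹ * a⁻¹ * x = x⁻¹ * (a⁻¹ * g) * x⁻¹⁻¹) ↔ g = 1 := by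
      intro a
      rw [inv_inv, mul_left_inj, mul_right_inj, eq_comm, mul_eq_left]
    simp only [e]
    by_cases hg : g = 1
    · simp only [hg, if_true, map_one, one_def, inv_mul_cancel]
      refine Fintype.sum_equiv ((Equiv.inv G).trans (MulAut.conj x⁻¹).toEquiv) _ _ fun a => ?_
      simp
    · simp [hg]
  mul_antipode_lTensor_comul := by
    classical
    refine lin_ext fun g x => ?_
    simp only [LinearMap.comp_apply, comul_elt, map_sum, LinearMap.lTensor_tmul, counit_elt,
      lift_elt, LinearMap.mul'_apply, elt_mul_elt, Algebra.linearMap_apply]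
    have e : ∀ a : G, (a = x * (x⁻¹ * (a⁻¹ * g)⁻¹ * x) * x⁻¹) ↔ g = 1 := by
      intro a
      have : x * (x⁻¹ * (a⁻¹ * g)⁻¹ * x) * x⁻¹ = g⁻¹ * a := by group
      rw [this, eq_comm, mul_eq_right, inv_eq_one]
    simp only [e]
    by_cases hg : g = 1
    · simp only [hg, if_true, map_one, one_def, mul_inv_cancel]
    · simp [hg]

end

end DrinfeldDouble

/-! ### Higher Frobenius-Schur indicators -/

section Indicators

/-- `Λ` is a normalized (two-sided) integral of the Hopf algebra `H`. -/
def IsNormalizedIntegral {H : Type*} [Ring H] [HopfAlgebra ℂ H] (Λ : H) : Prop :=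
  (∀ h : H, h * Λ = Coalgebra.counit (R := ℂ) h • Λ) ∧
    (∀ h : H, Λ * h = Coalgebra.counit (R := ℂ) h • Λ) ∧ Coalgebra.counit (R := ℂ) Λ = 1

/-- The Sweedler power `h ↦ h^{[n]} = h₁ h₂ ⋯ hₙ`, with `h^{[0]} = ε(h) 1`. -/
noncomputable def sweedlerPow {H : Type*} [Ring H] [HopfAlgebra ℂ H] : ℕ → H →ₗ[ℂ] H
  | 0 => Algebra.linearMap ℂ H ∘ₗ Coalgebra.counit
  | n + 1 => LinearMap.mul' ℂ H ∘ₗ (sweedlerPow n).rTensor H ∘ₗ Coalgebra.comul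

/-- The normalized integral `Λ = |G|⁻¹ ∑_x e_1 ⊗ x` of `D(G)`. -/
noncomputable def DrinfeldDouble.integral (G : Type u) [Group G] [Fintype G] :
    DrinfeldDouble G :=
  (Fintype.card G : ℂ)⁻¹ • ∑ x : G, DrinfeldDouble.elt 1 x

theorem DrinfeldDouble.isNormalizedIntegral_integral (G : Type u) [Group G] [Fintype G] :
    IsNormalizedIntegral (DrinfeldDouble.integral G) := by
  classical
  have hl : ∀ g x : G, elt g x * ∑ y : G, elt 1 y =
      Coalgebra.counit (R := ℂ) (elt g x) • ∑ y : G, elt 1 y := by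
    intro g x
    simp only [Finset.mul_sum, elt_mul_elt, counit_elt]
    by_cases hg : g = 1
    · simp only [hg, mul_one, mul_inv_cancel, if_true, one_smul]
      exact Fintype.sum_equiv (Equiv.mulLeft x) _ _ fun b => by simp
    · simp [hg]
  have hr : ∀ g x : G, (∑ y : G, elt 1 y) * elt g x =
      Coalgebra.counit (R := ℂ) (elt g x) • ∑ y : G, elt 1 y := by
    intro g x
    simp only [Finset.sum_mul, elt_mul_elt, counit_elt]
    have e : ∀ y : G, (1 = y * g * y⁻¹) ↔ g = 1 := by
      intro y
      rw [eq_comm, mul_inv_eq_one, mul_eq_left]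
    simp only [e]
    by_cases hg : g = 1
    · simp only [hg, if_true, one_smul]
      exact Fintype.sum_equiv (Equiv.mulRight x) _ _ fun b => by simp
    · simp [hg]
  refine ⟨fun h => ?_, fun h => ?_, ?_⟩
  · unfold integral
    rw [mul_smul_comm, smul_comm]
    congr 1
    induction h using induction with
    | h0 => simp
    | hadd a b ha hb => rw [add_mul, map_add, add_smul, ha, hb]
    | hs c g x => rw [smul_mul_assoc, map_smul, smul_assoc, hl]
  · unfold integral
    rw [smul_mul_assoc, smul_comm]
    congr 1
    induction h using induction with
    | h0 => simp
    | hadd a b ha hb => rw [mul_add, map_add, add_smul, ha, hb]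
    | hs c g x => rw [mul_smul_comm, map_smul, smul_assoc, hr]
  · unfold integral
    rw [map_smul, map_sum]
    simp [counit_elt]

/-- The `n`-th Frobenius-Schur indicator `ν_n(V) = χ_V(Λ^{[n]})` of a finite-dimensional
representation `V` of `D(G)`. -/
noncomputable def fsIndicator (G : Type u) [Group G] [Fintype G] (n : ℕ) (V : Type u)
    [AddCommGroup V] [Module ℂ V] [Module (DrinfeldDouble G) V]
    [IsScalarTower ℂ (DrinfeldDouble G) V] : ℂ :=
  LinearMap.trace ℂ V (Algebra.lsmul ℂ ℂ V (sweedlerPow n (DrinfeldDouble.integral G)))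

/-- `G` is an `FSZ_n`-group: `ν_n(V)` is an integer for every irreducible representation `V`
of `D(G)`. -/
def IsFSZn (n : ℕ) (G : Type u) [Group G] [Fintype G] : Prop :=
  ∀ (V : Type u) [AddCommGroup V] [Module ℂ V] [Module (DrinfeldDouble G) V]
    [IsScalarTower ℂ (DrinfeldDouble G) V] [FiniteDimensional ℂ V]
    [IsSimpleModule (DrinfeldDouble G) V], ∃ m : ℤ, fsIndicator G n V = m

/-- `G` is an `FSZ`-group: it is an `FSZ_n`-group for all positive integers `n`. -/
def IsFSZ (G : Type u) [Group G] [Fintype G] : Prop :=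
  ∀ n : ℕ, 0 < n → IsFSZn n G

end Indicators

/-! ### The groups -/

section Groups

/-- A regular `p`-group in the sense of P. Hall: for all `a, b` and every power `q` of `p`,
`(a b)^q = a^q b^q c₁^q ⋯ c_t^q` for some elements `c₁, …, c_t` of the commutator subgroup of the
subgroup generated by `a` and `b`. -/
def IsRegularPGroup (p : ℕ) (G : Type*) [Group G] : Prop :=
  IsPGroup p G ∧ ∀ (a b : G) (k : ℕ), ∃ L : List G,
    (∀ c ∈ L, c ∈ ⁅Subgroup.closure {a, b}, Subgroup.closure {a, b}⁆) ∧
      (a * b) ^ p ^ k = a ^ p ^ k * b ^ p ^ k * (L.map fun c => c ^ p ^ k).prod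

/-- An irregular `p`-group. -/
def IsIrregularPGroup (p : ℕ) (G : Type*) [Group G] : Prop :=
  IsPGroup p G ∧ ¬ IsRegularPGroup p G

/-- The elements `s 0, …, s 5` generate `G` and satisfy the power-commutator relations with
parameters `a, b, x, y, w ∈ ℤ/5` below. The relations allow every element to be written as
`s₀^{i₀} ⋯ s₅^{i₅}` with `0 ≤ i_k < 5`, so a group of order `5 ^ 6` with such elements is
determined by the parameters up to isomorphism. -/
structure IsPcPresented (a b x y w : ZMod 5) {G : Type*} [Group G] (s : Fin 6 → G) : Prop where
  gen : Subgroup.closure (Set.range s) = ⊤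
  pow0 : s 0 ^ 5 = s 5 ^ a.val
  pow1 : s 1 ^ 5 = s 5 ^ b.val
  pow2 : s 2 ^ 5 = 1
  pow3 : s 3 ^ 5 = 1
  pow4 : s 4 ^ 5 = 1
  pow5 : s 5 ^ 5 = 1
  rel10 : s 1 * s 0 = s 0 * s 1 * s 2
  rel20 : s 2 * s 0 = s 0 * s 2 * s 3
  rel30 : s 3 * s 0 = s 0 * s 3 * s 4
  rel40 : s 4 * s 0 = s 0 * s 4 * s 5
  rel21 : s 2 * s 1 = s 1 * s 2 * (s 4 ^ x.val * s 5 ^ y.val)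
  rel31 : s 3 * s 1 = s 1 * s 3 * s 5 ^ (x + w).val
  rel41 : s 4 * s 1 = s 1 * s 4 * s 5 ^ w.val
  rel32 : s 3 * s 2 = s 2 * s 3 * s 5 ^ (-w).val
  rel42 : s 4 * s 2 = s 2 * s 4
  rel43 : s 4 * s 3 = s 3 * s 4
  rel5 : ∀ k : Fin 6, s 5 * s k = s k * s 5

end Groups

/-! All parts rest on the formula ν_n(V) = |G|⁻¹ ∑ χ(e_a ⊗ xⁿ), the sum running over the pairs (a,
x) with (a x⁻¹)ⁿ xⁿ = 1 (`fsIndicator_eq_sum`).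

Non-integrality. Indicators add up along a submodule and its quotient, so FSZ_n makes them integral
on every finite-dimensional module. For the left ideal generated by e_u times the idempotent of a
character φ of a central subgroup, this says that ∑_c φ(c) N_u(c) is an integer, where N_u(c) is the
number of t with tⁿ = (ut)ⁿ = c. Take n = 5, the central subgroup generated by s₅, and φ(s₅) = ζ a
primitive fifth root of unity. The only rational relation among 1, ζ, …, ζ⁴, up to scaling, is that
their sum vanishes, so N_u(s₅ᵗ) must be the same for all t ≠ 0. In M(a, b, x, y, w) the fifth power
of s₀ⁱ s₁ʲ ⋯ is s₅ to the power f(i, j) = ai + bj + i⁴j + 3wi³j² (`PcGroup.pow_five`). Hence N_u is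
625 times a count over (ℤ/5)² that involves neither x nor y, and a finite check refutes constancy
(`PcGroup.exists_pairCount_ne`). Moreover f is not additive, while commutators have trivial fifth
power; this gives irregularity, and f ≠ 0 gives exponent 25.

The field ℚ(√5). On V^⊗5 the integral acts as an idempotent P commuting with the cyclic shift σ, and
ν_5(V) is the trace of Pσ⁴ as well as of Pσ. If c_k is the multiplicity of ζᵏ as an eigenvalue of
Pσ, then ν_5(V) = ∑ c_k ζᵏ = ∑ c_k ζ⁻ᵏ, an algebraic integer fixed by inversion of ζ, hence in
ℚ(√5). A rational algebraic integer is an integer.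

Products. Pulling a module back along a surjection D(F × H) → D(F) preserves its indicators;
products of one bad group with cyclic groups then have infinitely many orders. -/

namespace DrinfeldDouble

/-! ### Sweedler powers and the indicator as a sum over the group -/

variable {G : Type u} [Group G] [Fintype G]

-- In the n-fold coproduct, (e_{a₁} ⊗ x) ⋯ (e_{aₙ} ⊗ x) vanishes unless a_{i+1} = x⁻¹ a_i x for all
-- i. One entry a = a₁ then determines the others, and their product telescopes to (a x⁻¹)ⁿ xⁿ.
open Classical in
theorem sweedlerPow_elt (n : ℕ) (g x : G) :
    sweedlerPow n (elt g x) =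
      ∑ a : G, if (a * x⁻¹) ^ n * x ^ n = g then elt a (x ^ n) else 0 := by
  induction n generalizing g with
  | zero =>
    simp only [sweedlerPow, LinearMap.comp_apply, counit_elt, Algebra.linearMap_apply, pow_zero,
      mul_one]
    by_cases hg : g = 1
    · simp [hg, one_def]
    · simp [hg, Ne.symm hg]
  | succ n ih =>
    simp only [sweedlerPow, LinearMap.comp_apply, comul_elt, map_sum, LinearMap.rTensor_tmul,
      LinearMap.mul'_apply, ih, Finset.sum_mul, ite_mul, zero_mul, elt_mul_elt]
    rw [Finset.sum_comm]
    refine Finset.sum_congr rfl fun a _ => ?_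
    rw [Finset.sum_ite_eq]
    simp only [Finset.mem_univ, if_true, ← pow_succ]
    refine if_congr ?_ rfl rfl
    have e : (a * x⁻¹) ^ (n + 1) * x ^ (n + 1) = (a * x⁻¹) ^ n * a * x ^ n := by
      rw [pow_succ, pow_succ' x]; group
    rw [e]
    constructor
    · intro h
      have h2 := congrArg (fun t => (a * x⁻¹) ^ n * t * x ^ n) h
      beta_reduce at h2
      rw [h2]; group
    · rintro rfl
      group

open Classical in
theorem sweedlerPow_integral (n : ℕ) :
    sweedlerPow n (integral G) = (Fintype.card G : ℂ)⁻¹ •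
      ∑ x : G, ∑ a : G, if (a * x⁻¹) ^ n * x ^ n = 1 then elt a (x ^ n) else 0 := by
  unfold integral
  rw [map_smul, map_sum]
  simp only [sweedlerPow_elt]

/-- The trace of the action of an element of `D(G)` on a module. -/
noncomputable def character (V : Type u) [AddCommGroup V] [Module ℂ V]
    [Module (DrinfeldDouble G) V] [IsScalarTower ℂ (DrinfeldDouble G) V] :
    DrinfeldDouble G →ₗ[ℂ] ℂ :=
  LinearMap.trace ℂ V ∘ₗ (Algebra.lsmul ℂ ℂ V).toLinearMap

theorem fsIndicator_eq_character (n : ℕ) (V : Type u) [AddCommGroup V] [Module ℂ V]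
    [Module (DrinfeldDouble G) V] [IsScalarTower ℂ (DrinfeldDouble G) V] :
    fsIndicator G n V = character V (sweedlerPow n (integral G)) := rfl

open Classical in
theorem fsIndicator_eq_sum (n : ℕ) (V : Type u) [AddCommGroup V] [Module ℂ V]
    [Module (DrinfeldDouble G) V] [IsScalarTower ℂ (DrinfeldDouble G) V] :
    fsIndicator G n V = (Fintype.card G : ℂ)⁻¹ *
      ∑ x : G, ∑ a : G,
        if (a * x⁻¹) ^ n * x ^ n = 1 then character V (elt a (x ^ n)) else 0 := by
  rw [fsIndicator_eq_character, sweedlerPow_integral, map_smul, smul_eq_mul]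
  simp only [map_sum, apply_ite (character V), map_zero]

end DrinfeldDouble

/-- The trace of an endomorphism is the sum of the traces on an invariant subspace and on the
quotient by it. -/
theorem LinearMap.trace_eq_add_of_invariant {K V W Q : Type*} [Field K] [AddCommGroup V]
    [Module K V] [FiniteDimensional K V] [AddCommGroup W] [Module K W] [AddCommGroup Q]
    [Module K Q] (i : W →ₗ[K] V) (q : V →ₗ[K] Q) (hi : Function.Injective i)
    (hq : Function.Surjective q) (hiq : LinearMap.range i = LinearMap.ker q)
    (f : V →ₗ[K] V) (fW : W →ₗ[K] W) (fQ : Q →ₗ[K] Q)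
    (h1 : f ∘ₗ i = i ∘ₗ fW) (h2 : q ∘ₗ f = fQ ∘ₗ q) :
    LinearMap.trace K V f = LinearMap.trace K W fW + LinearMap.trace K Q fQ := by
  have : FiniteDimensional K W := FiniteDimensional.of_injective i hi
  have : FiniteDimensional K Q := FiniteDimensional.of_surjective q hq
  obtain ⟨s, hs⟩ := q.exists_rightInverse_of_surjective (LinearMap.range_eq_top.2 hq)
  have hs' : ∀ y, q (s y) = y := fun y => LinearMap.congr_fun hs y
  have hmem : ∀ v, v - s (q v) ∈ LinearMap.range i := by
    intro v
    rw [hiq, LinearMap.mem_ker, map_sub, hs', sub_self]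
  let e := LinearEquiv.ofInjective i hi
  let p : V →ₗ[K] W := e.symm.toLinearMap ∘ₗ
    (LinearMap.id - s ∘ₗ q).codRestrict (LinearMap.range i) hmem
  have hp : ∀ v, i (p v) = v - s (q v) := by
    intro v
    have : ((e (p v) : LinearMap.range i) : V) = v - s (q v) := by simp [p]
    rw [← this]; rfl
  have hqi : ∀ w, q (i w) = 0 := fun w => by
    rw [← LinearMap.mem_ker, ← hiq]; exact ⟨w, rfl⟩
  -- The splitting v = i(p v) + s(q v) is only linear, not `f`-invariant. Cyclicity of the trace
  -- turns the two summands into p f i and q f s, which are the induced maps.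
  have hf : f = (f ∘ₗ i) ∘ₗ p + (f ∘ₗ s) ∘ₗ q := by
    ext v
    simp [hp]
  have e1 : p ∘ₗ f ∘ₗ i = fW := by
    ext w
    apply hi
    rw [h1]
    simp [hp, hqi]
  have e2 : q ∘ₗ f ∘ₗ s = fQ := by
    rw [← LinearMap.comp_assoc, h2, LinearMap.comp_assoc, hs, LinearMap.comp_id]
  conv_lhs => rw [hf]
  rw [map_add, LinearMap.trace_comp_comm' p (f ∘ₗ i), LinearMap.trace_comp_comm' q (f ∘ₗ s),
    e1, e2]

/-! ### Integrality passes from irreducible to arbitrary modules -/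

namespace DrinfeldDouble

variable {G : Type u} [Group G] [Fintype G]

/-- If the indicators of all irreducible modules are integers, so are those of all
finite-dimensional modules. -/
theorem exists_int_fsIndicator_of_isFSZn {n : ℕ} (hG : IsFSZn n G) (d : ℕ) (V : Type u)
    [AddCommGroup V] [Module ℂ V] [Module (DrinfeldDouble G) V]
    [IsScalarTower ℂ (DrinfeldDouble G) V] [FiniteDimensional ℂ V]
    (hd : Module.finrank ℂ V ≤ d) : ∃ m : ℤ, fsIndicator G n V = m := by
  induction d generalizing V with
  | zero =>
    have h0 : Module.finrank ℂ V = 0 := Nat.le_zero.1 hd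
    have : Subsingleton V := Module.finrank_zero_iff.1 h0
    refine ⟨0, ?_⟩
    unfold fsIndicator
    rw [Subsingleton.elim (Algebra.lsmul ℂ ℂ V (sweedlerPow n (integral G)) : V →ₗ[ℂ] V) 0,
      map_zero, Int.cast_zero]
  | succ d ih =>
    by_cases hs : IsSimpleModule (DrinfeldDouble G) V
    · exact hG V
    by_cases hV : Subsingleton V
    · exact ih V (by rw [Module.finrank_zero_iff.2 hV]; exact Nat.zero_le _)
    have hV' : Nontrivial V := not_subsingleton_iff_nontrivial.1 hV
    have : ∃ W : Submodule (DrinfeldDouble G) V, W ≠ ⊥ ∧ W ≠ ⊤ := by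
      by_contra hcon
      push Not at hcon
      apply hs
      rw [isSimpleModule_iff]
      exact { eq_bot_or_eq_top := fun W => or_iff_not_imp_left.2 (hcon W) }
    obtain ⟨W, hW0, hW1⟩ := this
    let i : W →ₗ[ℂ] V := W.subtype.restrictScalars ℂ
    let q : V →ₗ[ℂ] V ⧸ W := W.mkQ.restrictScalars ℂ
    have hi : Function.Injective i := W.injective_subtype
    have hq : Function.Surjective q := W.mkQ_surjective
    have hiq : LinearMap.range i = LinearMap.ker q := by
      ext v
      simp [i, q]
    have : FiniteDimensional ℂ W := FiniteDimensional.of_injective i hi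
    have : FiniteDimensional ℂ (V ⧸ W) := FiniteDimensional.of_surjective q hq
    have hr : Module.finrank ℂ W + Module.finrank ℂ (V ⧸ W) = Module.finrank ℂ V := by
      have h := q.finrank_range_add_finrank_ker
      rw [← hiq, LinearMap.finrank_range_of_inj hi, LinearMap.range_eq_top.2 hq,
        finrank_top] at h
      omega
    have hWn : Nontrivial W := Submodule.nontrivial_iff_ne_bot.2 hW0
    have hQn : Nontrivial (V ⧸ W) := Submodule.Quotient.nontrivial_iff.2 hW1
    have hWp : 0 < Module.finrank ℂ W := Module.finrank_pos
    have hQp : 0 < Module.finrank ℂ (V ⧸ W) := Module.finrank_pos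
    obtain ⟨m1, hm1⟩ := ih W (by omega)
    obtain ⟨m2, hm2⟩ := ih (V ⧸ W) (by omega)
    refine ⟨m1 + m2, ?_⟩
    rw [Int.cast_add, ← hm1, ← hm2]
    unfold fsIndicator
    refine LinearMap.trace_eq_add_of_invariant i q hi hq hiq _ _ _ ?_ ?_
    · ext v; rfl
    · ext v; rfl

end DrinfeldDouble

/-! ### Modules generated by central idempotents, and counting common n-th powers -/

namespace DrinfeldDouble

variable {G : Type u}

/-- The basis `e_g ⊗ x` of `D(G)`. -/
noncomputable def stdBasis (G : Type u) : Module.Basis (G × G) ℂ (DrinfeldDouble G) :=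
  (Finsupp.basisSingleOne : Module.Basis (G × G) ℂ (G × G →₀ ℂ))

theorem stdBasis_apply (i : G × G) : stdBasis G i = elt i.1 i.2 :=
  congrFun Finsupp.coe_basisSingleOne i

open Classical in
theorem stdBasis_repr_elt (g x : G) (i : G × G) :
    (stdBasis G).repr (elt g x) i = if (g, x) = i then 1 else 0 := by
  have : elt g x = stdBasis G (g, x) := (stdBasis_apply (g, x)).symm
  rw [this, Module.Basis.repr_self, Finsupp.single_apply]

instance [Finite G] : FiniteDimensional ℂ (DrinfeldDouble G) :=
  Module.Finite.of_basis (stdBasis G)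

variable [Group G] [Fintype G]

/-- The left ideal generated by `p`, as the range of right multiplication. -/
noncomputable abbrev leftIdeal (p : DrinfeldDouble G) :
    Submodule (DrinfeldDouble G) (DrinfeldDouble G) :=
  LinearMap.range (LinearMap.toSpanSingleton (DrinfeldDouble G) (DrinfeldDouble G) p)

theorem character_leftIdeal {p : DrinfeldDouble G} (hp : p * p = p) (h : DrinfeldDouble G) :
    character (leftIdeal p) h =
      LinearMap.trace ℂ (DrinfeldDouble G)
        (LinearMap.mulLeft ℂ h ∘ₗ LinearMap.mulRight ℂ p) := by
  let i : leftIdeal p →ₗ[ℂ] DrinfeldDouble G := (leftIdeal p).subtype.restrictScalars ℂ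
  let q : DrinfeldDouble G →ₗ[ℂ] leftIdeal p :=
    (LinearMap.toSpanSingleton (DrinfeldDouble G) (DrinfeldDouble G) p).rangeRestrict.restrictScalars
      ℂ
  have hi : FiniteDimensional ℂ (leftIdeal p) :=
    FiniteDimensional.of_injective i (leftIdeal p).injective_subtype
  have hq : ∀ v, (q v : DrinfeldDouble G) = v * p := fun v => rfl
  -- The map v ↦ h v p factors through the projection v ↦ v p onto the ideal. By cyclicity its trace
  -- is that of h on the ideal, where right multiplication by `p` is the identity.
  have e1 : LinearMap.mulLeft ℂ h ∘ₗ LinearMap.mulRight ℂ p =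
      (LinearMap.mulLeft ℂ h ∘ₗ i) ∘ₗ q := by
    ext v; rfl
  rw [e1, LinearMap.trace_comp_comm' q (LinearMap.mulLeft ℂ h ∘ₗ i)]
  unfold character
  rw [LinearMap.comp_apply]
  congr 1
  ext ⟨v, w, rfl⟩
  change h * (w * p) = h * (w * p) * p
  rw [mul_assoc, mul_assoc, hp]

variable {A : Type*} [CommGroup A] [Fintype A]

/-- The idempotent of `D(G)` attached to `u : G` and a character of a central subgroup. -/
noncomputable def centralIdempotent (ι : A →* G) (φ : A →* ℂ) (u : G) : DrinfeldDouble G :=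
  (Fintype.card A : ℂ)⁻¹ • ∑ c : A, φ c • elt u (ι c)

theorem centralIdempotent_mul_self (ι : A →* G) (hι : ∀ c g, ι c * g = g * ι c) (φ : A →* ℂ)
    (u : G) : centralIdempotent ι φ u * centralIdempotent ι φ u = centralIdempotent ι φ u := by
  classical
  have hcard : (Fintype.card A : ℂ) ≠ 0 := Nat.cast_ne_zero.2 Fintype.card_ne_zero
  unfold centralIdempotent
  rw [smul_mul_smul_comm, mul_smul]
  congr 1
  rw [Finset.sum_mul_sum]
  have : ∀ c : A, ∑ d : A, φ c • elt u (ι c) * φ d • elt u (ι d) =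
      ∑ d : A, φ d • elt u (ι d) := by
    intro c
    refine Fintype.sum_equiv (Equiv.mulLeft c) _ _ fun d => ?_
    have : u = ι c * u * (ι c)⁻¹ := by rw [hι]; group
    rw [smul_mul_smul_comm, elt_mul_elt, if_pos this]
    simp
  rw [Finset.sum_congr rfl fun c _ => this c, Finset.sum_const, Finset.card_univ,
    ← Nat.cast_smul_eq_nsmul ℂ, smul_smul, inv_mul_cancel₀ hcard, one_smul]

-- The map sends e_g ⊗ x to a multiple of e_a ⊗ y x z, so a diagonal entry needs y z = 1 by
-- centrality of z. The remaining conditions are g = a and g = x u x⁻¹.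
open Classical in
theorem trace_elt_mul_elt (a y u z : G) (hz : ∀ g, z * g = g * z) :
    LinearMap.trace ℂ (DrinfeldDouble G)
        (LinearMap.mulLeft ℂ (elt a y) ∘ₗ LinearMap.mulRight ℂ (elt u z)) =
      if y = z⁻¹ then (∑ x : G, if a = x * u * x⁻¹ then 1 else 0 : ℂ) else 0 := by
  rw [LinearMap.trace_eq_matrix_trace ℂ (stdBasis G), Matrix.trace, Fintype.sum_prod_type,
    Finset.sum_comm]
  simp only [Matrix.diag_apply, LinearMap.toMatrix_apply, LinearMap.comp_apply,
    LinearMap.mulLeft_apply, LinearMap.mulRight_apply, stdBasis_apply]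
  have key : ∀ x g : G, (stdBasis G).repr (elt a y * (elt g x * elt u z)) (g, x) =
      if g = x * u * x⁻¹ then (if y = z⁻¹ ∧ a = g then 1 else 0) else 0 := by
    intro x g
    rw [elt_mul_elt]
    split_ifs with h1 h2
    · obtain ⟨rfl, rfl⟩ := h2
      rw [elt_mul_elt, if_pos, stdBasis_repr_elt, if_pos]
      · rw [← hz]; simp
      · have := hz a
        rw [inv_inv, mul_assoc, ← this]
        simp
    · rw [elt_mul_elt]
      split_ifs with h3
      · rw [stdBasis_repr_elt, if_neg]
        intro h4
        apply h2
        obtain ⟨h5, h6⟩ := Prod.mk.inj h4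
        refine ⟨?_, h5⟩
        rw [← hz, ← mul_assoc] at h6
        exact eq_inv_of_mul_eq_one_left (mul_eq_right.1 h6)
      · simp
    · simp
  simp only [key, Finset.sum_ite_eq', Finset.mem_univ, if_true]
  split_ifs with h <;> simp [h]

open Classical in
/-- The number of `t` with `t ^ n = c` and `(u t) ^ n = c`. -/
noncomputable def powPairCount (n : ℕ) (u c : G) : ℕ :=
  (Finset.univ.filter fun t : G => t ^ n = c ∧ (u * t) ^ n = c).card

theorem fsIndicator_leftIdeal_centralIdempotent (n : ℕ) (ι : A →* G)
    (hι : ∀ c g, ι c * g = g * ι c) (φ : A →* ℂ) (u : G) :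
    fsIndicator G n (leftIdeal (centralIdempotent ι φ u)) =
      (Fintype.card A : ℂ)⁻¹ * ∑ c : A, φ c * powPairCount n u (ι c) := by
  classical
  have hcard : (Fintype.card G : ℂ) ≠ 0 := Nat.cast_ne_zero.2 Fintype.card_ne_zero
  have hchar : ∀ a y : G, character (leftIdeal (centralIdempotent ι φ u)) (elt a y) =
      (Fintype.card A : ℂ)⁻¹ * ∑ c : A, φ c *
        if y = (ι c)⁻¹ then (∑ x : G, if a = x * u * x⁻¹ then 1 else 0 : ℂ) else 0 := by
    intro a y
    rw [character_leftIdeal (centralIdempotent_mul_self ι hι φ u)]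
    have : LinearMap.mulLeft ℂ (elt a y) ∘ₗ LinearMap.mulRight ℂ (centralIdempotent ι φ u) =
        (Fintype.card A : ℂ)⁻¹ • ∑ c : A, φ c •
          (LinearMap.mulLeft ℂ (elt a y) ∘ₗ LinearMap.mulRight ℂ (elt u (ι c))) := by
      refine LinearMap.ext fun v => ?_
      simp [centralIdempotent, Finset.mul_sum]
    rw [this, map_smul, map_sum, smul_eq_mul]
    simp only [map_smul, smul_eq_mul, trace_elt_mul_elt _ _ _ _ (hι _)]
  rw [fsIndicator_eq_sum]
  have hcount : ∀ c : A, (∑ t : G, ∑ a : G, if (a * t⁻¹) ^ n * t ^ n = 1 then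
      -- For each conjugator x, the substitution t ↦ x⁻¹ t⁻¹ x turns the conditions into tⁿ = (ut)ⁿ
      -- = c, centrality of c absorbing the conjugation. Each x thus contributes the same count,
      -- whence the factor |G|.
      (if t ^ n = (ι c)⁻¹ then (∑ x : G, if a = x * u * x⁻¹ then 1 else 0 : ℂ) else 0) else 0) =
      Fintype.card G * powPairCount n u (ι c) := by
    intro c
    have h1 : ∀ t : G, (∑ a : G, if (a * t⁻¹) ^ n * t ^ n = 1 then
        (if t ^ n = (ι c)⁻¹ then (∑ x : G, if a = x * u * x⁻¹ then 1 else 0 : ℂ) else 0) else 0) =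
        ∑ x : G, if t ^ n = (ι c)⁻¹ ∧ (x * u * x⁻¹ * t⁻¹) ^ n * t ^ n = 1 then 1 else 0 := by
      intro t
      by_cases ht : t ^ n = (ι c)⁻¹
      · simp only [ht, if_true, true_and]
        simp only [← ht]
        have : ∀ a : G, (if (a * t⁻¹) ^ n * t ^ n = 1 then
            (∑ x : G, if a = x * u * x⁻¹ then 1 else 0 : ℂ) else 0) =
            ∑ x : G, if a = x * u * x⁻¹ then
              (if (a * t⁻¹) ^ n * t ^ n = 1 then 1 else 0) else 0 := by
          intro a
          split_ifs <;> simp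
        rw [Finset.sum_congr rfl fun a _ => this a, Finset.sum_comm]
        simp
      · simp [ht]
    rw [Finset.sum_congr rfl fun t _ => h1 t, Finset.sum_comm]
    have h2 : ∀ x : G, (∑ t : G, if t ^ n = (ι c)⁻¹ ∧ (x * u * x⁻¹ * t⁻¹) ^ n * t ^ n = 1
        then (1 : ℂ) else 0) = powPairCount n u (ι c) := by
      intro x
      rw [powPairCount, Finset.natCast_card_filter]
      refine Fintype.sum_equiv ((Equiv.inv G).trans (MulAut.conj x⁻¹).toEquiv) _ _ fun t => ?_
      refine if_congr ?_ rfl rfl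
      have e1 : ((Equiv.inv G).trans (MulAut.conj x⁻¹).toEquiv) t = x⁻¹ * t⁻¹ * x := by simp
      rw [e1]
      have e2 : (x⁻¹ * t⁻¹ * x) ^ n = x⁻¹ * (t ^ n)⁻¹ * x := by
        have := conj_pow (i := n) (a := x⁻¹) (b := t⁻¹)
        rw [inv_inv] at this
        rw [this, inv_pow]
      have e3 : (u * (x⁻¹ * t⁻¹ * x)) ^ n = x⁻¹ * (x * u * x⁻¹ * t⁻¹) ^ n * x := by
        have := conj_pow (i := n) (a := x⁻¹) (b := x * u * x⁻¹ * t⁻¹)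
        rw [inv_inv] at this
        rw [← this]
        congr 1
        group
      have e4 : ∀ g : G, x⁻¹ * g * x = ι c ↔ g = ι c := by
        intro g
        have h := hι c x
        rw [mul_assoc, inv_mul_eq_iff_eq_mul, ← h, mul_left_inj]
      rw [e2, e3, e4, e4, mul_eq_one_iff_eq_inv]
      constructor
      · rintro ⟨h3, h4⟩
        rw [h3, inv_inv] at h4
        exact ⟨by rw [h3, inv_inv], h4⟩
      · rintro ⟨h3, h4⟩
        exact ⟨by rw [← h3, inv_inv], by rw [h4, h3]⟩
    rw [Finset.sum_congr rfl fun x _ => h2 x, Finset.sum_const, Finset.card_univ, nsmul_eq_mul]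
  have hswap : (∑ t : G, ∑ a : G, if (a * t⁻¹) ^ n * t ^ n = 1 then
        character (leftIdeal (centralIdempotent ι φ u)) (elt a (t ^ n)) else 0) =
      (Fintype.card A : ℂ)⁻¹ * ∑ c : A, φ c * (Fintype.card G * powPairCount n u (ι c)) := by
    have h1 : ∀ t a : G, (if (a * t⁻¹) ^ n * t ^ n = 1 then
        character (leftIdeal (centralIdempotent ι φ u)) (elt a (t ^ n)) else 0) =
        ∑ c : A, (Fintype.card A : ℂ)⁻¹ * (φ c * if (a * t⁻¹) ^ n * t ^ n = 1 then
          (if t ^ n = (ι c)⁻¹ then (∑ x : G, if a = x * u * x⁻¹ then 1 else 0 : ℂ) else 0)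
          else 0) := by
      intro t a
      split_ifs with h
      · rw [hchar, Finset.mul_sum]
      · simp
    simp only [h1, ← hcount]
    rw [Finset.sum_congr rfl fun t _ => Finset.sum_comm, Finset.sum_comm]
    simp only [Finset.mul_sum]
  rw [hswap]
  simp only [Finset.mul_sum]
  refine Finset.sum_congr rfl fun c _ => ?_
  field_simp

/-- If `G` is `FSZ_n`, the character sums of `c ↦ #{t | t ^ n = (u t) ^ n = c}` over central
subgroups are integers. -/
theorem exists_int_sum_powPairCount_of_isFSZn {n : ℕ} (hG : IsFSZn n G) (ι : A →* G)
    (hι : ∀ c g, ι c * g = g * ι c) (φ : A →* ℂ) (u : G) :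
    ∃ m : ℤ, ∑ c : A, φ c * powPairCount n u (ι c) = m := by
  obtain ⟨m, hm⟩ := exists_int_fsIndicator_of_isFSZn hG _
    (leftIdeal (centralIdempotent ι φ u)) le_rfl
  refine ⟨Fintype.card A * m, ?_⟩
  have hcard : (Fintype.card A : ℂ) ≠ 0 := Nat.cast_ne_zero.2 Fintype.card_ne_zero
  rw [fsIndicator_leftIdeal_centralIdempotent n ι hι, inv_mul_eq_iff_eq_mul₀ hcard] at hm
  rw [hm]
  push_cast
  rfl

end DrinfeldDouble

/-! ### Relations between roots of unity, and traces of matrices with finite-order spectrum -/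

/-- The coefficients of an integral relation between the powers `1, ζ, …, ζ ^ (p - 1)` of a
primitive `p`-th root of unity are all equal, `p` prime. -/
theorem IsPrimitiveRoot.eq_of_sum_mul_pow_eq_zero {p : ℕ} [hp : Fact p.Prime] {ζ : ℂ}
    (hζ : IsPrimitiveRoot ζ p) (c : ℕ → ℤ)
    (h : ∑ k ∈ Finset.range p, (c k : ℂ) * ζ ^ k = 0) (k : ℕ) (hk : k < p) :
    c k = c (p - 1) := by
  open Polynomial in
  obtain ⟨q, rfl⟩ : ∃ q, p = q + 1 := ⟨p - 1, (Nat.succ_pred_eq_of_pos hp.out.pos).symm⟩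
  simp only [Nat.add_sub_cancel]
  have hgeom := hζ.geom_sum_eq_zero hp.out.one_lt
  rw [Finset.sum_range_succ] at h hgeom
  -- Eliminating ζ^q by the vanishing geometric sum leaves a polynomial of degree below q = φ(p)
  -- that kills ζ; divisibility by the cyclotomic polynomial forces it to be zero.
  let f : ℤ[X] := ∑ k ∈ Finset.range q, C (c k - c q) * X ^ k
  have hf : aeval ζ f = 0 := by
    have : aeval ζ f = ∑ k ∈ Finset.range q, ((c k : ℂ) - c q) * ζ ^ k := by
      simp [f, map_sum]
    rw [this]
    simp only [sub_mul, Finset.sum_sub_distrib, ← Finset.mul_sum]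
    linear_combination h - (c q : ℂ) * hgeom
  have hdvd : cyclotomic (q + 1) ℤ ∣ f := by
    rw [cyclotomic_eq_minpoly hζ hp.out.pos]
    exact minpoly.isIntegrallyClosed_dvd (hζ.isIntegral hp.out.pos) hf
  have hf0 : f = 0 := by
    by_contra hne
    have h1 := Polynomial.degree_le_of_dvd hdvd hne
    have h2 : f.degree < q := by
      refine (Polynomial.degree_sum_le _ _).trans_lt ?_
      rw [Finset.sup_lt_iff (by exact WithBot.bot_lt_coe q)]
      intro k hk
      exact (degree_C_mul_X_pow_le _ _).trans_lt (by exact_mod_cast Finset.mem_range.1 hk)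
    rw [degree_cyclotomic, Nat.totient_prime hp.out, Nat.add_sub_cancel] at h1
    exact absurd h2 (not_lt.2 h1)
  rcases Nat.lt_succ_iff_lt_or_eq.1 hk with hk | rfl
  · have : f.coeff k = c k - c q := by
      simp only [f, finsetSum_coeff, coeff_C_mul_X_pow, Finset.sum_ite_eq, Finset.mem_range, hk,
        if_true]
    rw [hf0, coeff_zero] at this
    omega
  · rfl

section Traces

variable {I : Type*} [Fintype I] [DecidableEq I]

theorem Matrix.exists_nat_trace_of_isIdempotentElem (P : Matrix I I ℂ) (hP : P * P = P) :
    ∃ m : ℕ, P.trace = m := by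
  have h : LinearMap.IsProj (LinearMap.range (Matrix.toLin' P)) (Matrix.toLin' P) := by
    refine ⟨fun x => ⟨x, rfl⟩, ?_⟩
    rintro _ ⟨x, rfl⟩
    rw [← LinearMap.comp_apply, ← Matrix.toLin'_mul, hP]
  exact ⟨_, by rw [← Matrix.trace_toLin'_eq, h.trace]⟩

/-- If `E ^ (n + 1) = E`, the traces of the powers of `E` are power sums of `n`-th roots of
unity. -/
theorem Matrix.exists_trace_pow_eq_sum {n : ℕ} {ζ : ℂ} (hn : 0 < n) (hζ : IsPrimitiveRoot ζ n)
    (E : Matrix I I ℂ) (hE : E ^ (n + 1) = E) :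
    ∃ c : ℕ → ℕ, ∀ m < n, (E ^ (m + 1)).trace =
      ∑ k ∈ Finset.range n, (c k : ℂ) * ζ ^ (k * (m + 1)) := by
  have hζ0 : ζ ≠ 0 := hζ.ne_zero hn.ne'
  have hn0 : (n : ℂ) ≠ 0 := Nat.cast_ne_zero.2 hn.ne'
  -- The spectral projection of `E` for the eigenvalue ζ^k. The exponents run from 1 to n, not from
  -- 0, because `E` may have a kernel: Eⁿ is idempotent but need not be 1.
  let R : ℕ → Matrix I I ℂ := fun k => (n : ℂ)⁻¹ •
    ∑ j ∈ Finset.range n, (ζ⁻¹ ^ k) ^ (j + 1) • E ^ (j + 1)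
  have hinv : ∀ k, ζ⁻¹ ^ k * ζ ^ k = 1 := fun k => by
    rw [← mul_pow, inv_mul_cancel₀ hζ0, one_pow]
  have hpow : ∀ k, (ζ⁻¹ ^ k) ^ n = 1 := fun k => by
    rw [pow_right_comm, inv_pow, hζ.pow_eq_one, inv_one, one_pow]
  have h1 : ∀ k, E * R k = ζ ^ k • R k := by
    intro k
    simp only [R, Matrix.mul_smul]
    rw [smul_comm]
    congr 1
    rw [Finset.mul_sum, Finset.smul_sum]
    have e : ∀ j, E * (ζ⁻¹ ^ k) ^ (j + 1) • E ^ (j + 1) =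
        ζ ^ k • (ζ⁻¹ ^ k) ^ (j + 1 + 1) • E ^ (j + 1 + 1) := by
      intro j
      rw [Matrix.mul_smul, ← pow_succ', smul_smul, pow_succ (ζ⁻¹ ^ k) (j + 1), mul_comm (ζ ^ k),
        mul_assoc, hinv, mul_one]
    rw [Finset.sum_congr rfl fun j _ => e j, ← Finset.smul_sum, ← Finset.smul_sum]
    congr 1
    have h2 := Finset.sum_range_succ (fun j => (ζ⁻¹ ^ k) ^ (j + 1) • E ^ (j + 1)) n
    rw [Finset.sum_range_succ'] at h2
    rw [hE, pow_succ (ζ⁻¹ ^ k) n, hpow, one_mul, zero_add, pow_one, pow_one] at h2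
    exact add_right_cancel h2
  have h2 : ∀ k j, E ^ j * R k = (ζ ^ k) ^ j • R k := by
    intro k j
    induction j with
    | zero => simp
    | succ j ih => rw [pow_succ, mul_assoc, h1, Matrix.mul_smul, ih, smul_smul, pow_succ']
  have h3 : ∀ k, R k * R k = R k := by
    intro k
    have : R k * R k = (n : ℂ)⁻¹ • ∑ j ∈ Finset.range n,
        ((ζ⁻¹ ^ k) ^ (j + 1) • E ^ (j + 1)) * R k := by
      conv_lhs => enter [1]; simp only [R]
      rw [Matrix.smul_mul, Finset.sum_mul]
    rw [this]
    have e : ∀ j, ((ζ⁻¹ ^ k) ^ (j + 1) • E ^ (j + 1)) * R k = R k := by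
      intro j
      rw [Matrix.smul_mul, h2, smul_smul, ← mul_pow, hinv, one_pow, one_smul]
    rw [Finset.sum_congr rfl fun j _ => e j, Finset.sum_const, Finset.card_range,
      ← Nat.cast_smul_eq_nsmul ℂ, smul_smul, inv_mul_cancel₀ hn0, one_smul]
  choose c hc using fun k => Matrix.exists_nat_trace_of_isIdempotentElem (R k) (h3 k)
  refine ⟨c, fun m hm => ?_⟩
  -- Fourier inversion on ℤ/n: the inner geometric sums vanish except at j = m.
  have h4 : ∑ k ∈ Finset.range n, ζ ^ (k * (m + 1)) • R k = E ^ (m + 1) := by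
    have e : ∀ k, ζ ^ (k * (m + 1)) • R k = (n : ℂ)⁻¹ • ∑ j ∈ Finset.range n,
        ((ζ ^ (m + 1) * ζ⁻¹ ^ (j + 1)) ^ k) • E ^ (j + 1) := by
      intro k
      simp only [R]
      rw [smul_comm, Finset.smul_sum]
      congr 1
      refine Finset.sum_congr rfl fun j _ => ?_
      rw [smul_smul, mul_pow, ← pow_mul, ← pow_mul, ← pow_mul, mul_comm k, mul_comm k]
    rw [Finset.sum_congr rfl fun k _ => e k, ← Finset.smul_sum, Finset.sum_comm]
    simp only [← Finset.sum_smul]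
    rw [Finset.sum_eq_single m]
    · rw [inv_pow, mul_inv_cancel₀ (pow_ne_zero _ hζ0)]
      simp [smul_smul, hn0]
    · intro j hj hjm
      have hne : ζ ^ (m + 1) * ζ⁻¹ ^ (j + 1) ≠ 1 := by
        rw [inv_pow, ← div_eq_mul_inv, Ne, div_eq_one_iff_eq (pow_ne_zero _ hζ0), pow_succ,
          pow_succ]
        intro h
        exact hjm (hζ.pow_inj hm (Finset.mem_range.1 hj) (mul_right_cancel₀ hζ0 h)).symm
      have h0 : ∑ k ∈ Finset.range n, (ζ ^ (m + 1) * ζ⁻¹ ^ (j + 1)) ^ k = 0 := by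
        rw [geom_sum_eq hne, mul_pow, pow_right_comm, hζ.pow_eq_one, pow_right_comm, inv_pow,
          hζ.pow_eq_one]
        simp
      rw [h0, zero_smul]
    · intro h
      exact absurd (Finset.mem_range.2 hm) h
  rw [← h4, Matrix.trace_sum]
  refine Finset.sum_congr rfl fun k _ => ?_
  rw [Matrix.trace_smul, hc, smul_eq_mul, mul_comm]

/-- If the idempotent matrix `P` is invariant under a permutation `s` of the index set, the powers
of `P` composed with `s` are `P` composed with the powers of `s`. -/
theorem Matrix.pow_submatrix_perm (P : Matrix I I ℂ) (hP : P * P = P) (s : Equiv.Perm I)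
    (hs : ∀ i j, P (s i) (s j) = P i j) (m : ℕ) :
    (P.submatrix s id) ^ (m + 1) = P.submatrix (s ^ (m + 1) : Equiv.Perm I) id := by
  induction m with
  | zero => simp
  | succ m ih =>
    rw [pow_succ', ih]
    ext i j
    rw [Matrix.mul_apply]
    have : ∀ l, P.submatrix s id i l * P.submatrix (s ^ (m + 1) : Equiv.Perm I) id l j =
        P ((s ^ (m + 2) : Equiv.Perm I) i) ((s ^ (m + 1) : Equiv.Perm I) l) *
          P ((s ^ (m + 1) : Equiv.Perm I) l) j := by
      intro l
      simp only [Matrix.submatrix_apply, id]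
      congr 1
      have h : ∀ (r : ℕ) (i j : I), P ((s ^ r : Equiv.Perm I) i) ((s ^ r : Equiv.Perm I) j) =
          P i j := by
        intro r
        induction r with
        | zero => simp
        | succ r ihr =>
          intro i j
          rw [pow_succ', Equiv.Perm.mul_apply, Equiv.Perm.mul_apply, hs, ihr]
      rw [← h (m + 1) (s i) l, ← Equiv.Perm.mul_apply, ← pow_succ]
    rw [Finset.sum_congr rfl fun l _ => this l,
      Equiv.sum_comp (s ^ (m + 1) : Equiv.Perm I)
        (fun l => P ((s ^ (m + 2) : Equiv.Perm I) i) l * P l j),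
      ← Matrix.mul_apply, hP]
    rfl

end Traces

/-! ### Direct products -/

namespace DrinfeldDouble

variable {F H : Type u} [Group F] [Fintype F] [Group H] [Fintype H]

open Classical in
/-- The algebra homomorphism `D(F × H) → D(F)` induced by the first projection of groups and
restriction of functions along `F → F × H`. -/
noncomputable def fstHom (F H : Type u) [Group F] [Fintype F] [Group H] [Fintype H] :
    DrinfeldDouble (F × H) →ₐ[ℂ] DrinfeldDouble F :=
  AlgHom.ofLinearMap (lift fun g x => if g.2 = 1 then elt g.1 x.1 else 0)
    (by
      rw [one_def, one_def, map_sum, Fintype.sum_prod_type]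
      simp)
    (by
      set L : DrinfeldDouble (F × H) →ₗ[ℂ] DrinfeldDouble F :=
        lift fun g x => if g.2 = 1 then elt g.1 x.1 else 0 with hL
      have key : (mulHom (G := F × H)).compr₂ L = (mulHom (G := F)).compl₁₂ L L := by
        refine lin_ext₂ fun g x h y => ?_
        rw [LinearMap.compr₂_apply, LinearMap.compl₁₂_apply, ← mul_def, ← mul_def, elt_mul_elt,
          hL, apply_ite (lift _), map_zero, lift_elt, lift_elt, lift_elt]
        obtain ⟨g1, g2⟩ := g
        obtain ⟨x1, x2⟩ := x
        obtain ⟨h1, h2⟩ := h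
        obtain ⟨y1, y2⟩ := y
        simp only [Prod.mk_mul_mk, Prod.inv_mk, Prod.mk.injEq]
        by_cases hg : g2 = 1
        · subst hg
          by_cases hh : h2 = 1
          · subst hh
            simp [elt_mul_elt]
          · have : ¬ 1 = x2 * h2 * x2⁻¹ := by
              rw [eq_comm, mul_inv_eq_one, mul_eq_left]
              exact hh
            simp [hh, this]
        · simp [hg]
      exact fun a b => LinearMap.congr_fun (LinearMap.congr_fun key a) b)

open Classical in
theorem fstHom_elt (g x : F × H) :
    fstHom F H (elt g x) = if g.2 = 1 then elt g.1 x.1 else 0 := by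
  rw [fstHom, AlgHom.ofLinearMap_apply, lift_elt]

theorem fstHom_surjective : Function.Surjective (fstHom F H) := by
  intro a
  induction a using induction with
  | h0 => exact ⟨0, map_zero _⟩
  | hadd a b ha hb =>
    obtain ⟨a', rfl⟩ := ha
    obtain ⟨b', rfl⟩ := hb
    exact ⟨a' + b', map_add _ _ _⟩
  | hs c g x =>
    refine ⟨c • elt (g, 1) (x, 1), ?_⟩
    rw [map_smul, fstHom_elt, if_pos rfl]

/-- An indicator of `F` is an indicator of `F × H`. -/
theorem isFSZn_of_isFSZn_prod {n : ℕ} (h : IsFSZn n (F × H)) : IsFSZn n F := by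
  classical
  intro V _ _ _ _ _ _
  let _ : Module (DrinfeldDouble (F × H)) V := Module.compHom V (fstHom F H).toRingHom
  have hsmul : ∀ (a : DrinfeldDouble (F × H)) (v : V), a • v = fstHom F H a • v := fun _ _ => rfl
  have : IsScalarTower ℂ (DrinfeldDouble (F × H)) V :=
    ⟨fun c a v => by rw [hsmul, hsmul, map_smul, smul_assoc]⟩
  have : RingHomSurjective (fstHom F H).toRingHom := ⟨fstHom_surjective⟩
  have : IsSimpleModule (DrinfeldDouble (F × H)) V := by
    -- The identity is semilinear over a surjective ring homomorphism, so both module structures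
    -- have the same submodules.
    let l : V →ₛₗ[(fstHom F H).toRingHom] V :=
      { toFun := id, map_add' := fun _ _ => rfl, map_smul' := fun _ _ => rfl }
    exact (LinearMap.isSimpleModule_iff_of_bijective l Function.bijective_id).2 inferInstance
  obtain ⟨m, hm⟩ := h V
  refine ⟨m, ?_⟩
  rw [← hm, fsIndicator_eq_sum, fsIndicator_eq_sum]
  have hchar : ∀ a : DrinfeldDouble (F × H), character V a = character V (fstHom F H a) :=
    fun a => rfl
  simp only [hchar, fstHom_elt, Fintype.sum_prod_type, Fintype.card_prod, Prod.mk_mul_mk,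
    Prod.inv_mk, Prod.pow_mk,
    Prod.mk_eq_one]
  have e : ∀ (x : F) (y : H) (a : F), (∑ b : H, if (a * x⁻¹) ^ n * x ^ n = 1 ∧
      (b * y⁻¹) ^ n * y ^ n = 1 then character V (if b = 1 then elt a (x ^ n) else 0) else 0) =
      if (a * x⁻¹) ^ n * x ^ n = 1 then character V (elt a (x ^ n)) else 0 := by
    intro x y a
    -- Only b = 1 survives, and then the condition on the H-component reads y⁻ⁿ yⁿ = 1. Summing over
    -- y gives a factor |H|, cancelled by |F × H|⁻¹.
    rw [Finset.sum_eq_single 1]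
    · simp
    · intro b _ hb
      simp [hb]
    · simp
  simp only [e, Finset.sum_const, Finset.card_univ, nsmul_eq_mul, Nat.cast_mul, ← Finset.mul_sum]
  have : (Fintype.card H : ℂ) ≠ 0 := Nat.cast_ne_zero.2 Fintype.card_ne_zero
  field_simp

end DrinfeldDouble

/-! ### The cyclic shift on the fifth tensor power, and ℚ(√5) -/

namespace DrinfeldDouble

open scoped Kronecker

variable {G : Type u} [Group G] [Fintype G] {I : Type*} [Fintype I] [DecidableEq I]

/-- The product of the entries of a 5-tuple. -/
def tupleProd (a : G × G × G × G × G) : G := a.1 * a.2.1 * a.2.2.1 * a.2.2.2.1 * a.2.2.2.2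

/-- The simultaneous action of `e_{a_i} ⊗ x` on the fifth tensor power. -/
noncomputable def tensorElt (ρ : DrinfeldDouble G →ₐ[ℂ] Matrix I I ℂ) (a : G × G × G × G × G)
    (x : G) : Matrix (I × I × I × I × I) (I × I × I × I × I) ℂ :=
  ρ (elt a.1 x) ⊗ₖ (ρ (elt a.2.1 x) ⊗ₖ (ρ (elt a.2.2.1 x) ⊗ₖ
    (ρ (elt a.2.2.2.1 x) ⊗ₖ ρ (elt a.2.2.2.2 x))))

/-- The entrywise conjugate `x a x⁻¹` of a 5-tuple. -/
def conjTuple (x : G) (a : G × G × G × G × G) : G × G × G × G × G :=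
  (x * a.1 * x⁻¹, x * a.2.1 * x⁻¹, x * a.2.2.1 * x⁻¹, x * a.2.2.2.1 * x⁻¹, x * a.2.2.2.2 * x⁻¹)

omit [Fintype G] in
theorem tupleProd_conjTuple (x : G) (a : G × G × G × G × G) :
    tupleProd (conjTuple x a) = x * tupleProd a * x⁻¹ := by
  simp only [tupleProd, conjTuple]
  group

open Classical in
theorem tensorElt_mul_tensorElt (ρ : DrinfeldDouble G →ₐ[ℂ] Matrix I I ℂ)
    (a b : G × G × G × G × G) (x y : G) :
    tensorElt ρ a x * tensorElt ρ b y =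
      if a = conjTuple x b then tensorElt ρ a (x * y) else 0 := by
  unfold tensorElt
  simp only [← Matrix.mul_kronecker_mul, ← map_mul, elt_mul_elt, apply_ite ρ, map_zero]
  obtain ⟨a0, a1, a2, a3, a4⟩ := a
  simp only [conjTuple, Prod.mk.injEq]
  by_cases h0 : a0 = x * b.1 * x⁻¹
  · by_cases h1 : a1 = x * b.2.1 * x⁻¹
    · by_cases h2 : a2 = x * b.2.2.1 * x⁻¹
      · by_cases h3 : a3 = x * b.2.2.2.1 * x⁻¹
        · by_cases h4 : a4 = x * b.2.2.2.2 * x⁻¹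
          · simp only [if_pos h0, if_pos h1, if_pos h2, if_pos h3, if_pos h4]
            rw [if_pos ⟨h0, h1, h2, h3, h4⟩]
          · simp [h4]
        · simp [h3]
      · simp [h2]
    · simp [h1]
  · simp [h0]

open Classical in
/-- The action of the integral on the fifth tensor power. -/
noncomputable def tensorIntegral (ρ : DrinfeldDouble G →ₐ[ℂ] Matrix I I ℂ) :
    Matrix (I × I × I × I × I) (I × I × I × I × I) ℂ :=
  (Fintype.card G : ℂ)⁻¹ • ∑ x : G, ∑ a : G × G × G × G × G,
    if tupleProd a = 1 then tensorElt ρ a x else 0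

/-- Conjugation by x permutes the tuples with product 1. The sums T_x over such tuples therefore
satisfy T_x T_y = T_{xy}, and their average over G is idempotent. -/
theorem tensorIntegral_mul_self (ρ : DrinfeldDouble G →ₐ[ℂ] Matrix I I ℂ) :
    tensorIntegral ρ * tensorIntegral ρ = tensorIntegral ρ := by
  classical
  have hcard : (Fintype.card G : ℂ) ≠ 0 := Nat.cast_ne_zero.2 Fintype.card_ne_zero
  have h1 : ∀ x y : G,
      (∑ a, if tupleProd a = 1 then tensorElt ρ a x else 0) *
        (∑ a, if tupleProd a = 1 then tensorElt ρ a y else 0) =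
      ∑ a, if tupleProd a = 1 then tensorElt ρ a (x * y) else 0 := by
    intro x y
    rw [Finset.sum_mul_sum]
    refine Finset.sum_congr rfl fun a _ => ?_
    rw [Finset.sum_eq_single (conjTuple x⁻¹ a)]
    · have e : a = conjTuple x (conjTuple x⁻¹ a) := by
        simp [conjTuple, mul_assoc]
      have e' : tupleProd (conjTuple x⁻¹ a) = 1 ↔ tupleProd a = 1 := by
        rw [tupleProd_conjTuple, inv_inv, mul_assoc, inv_mul_eq_one, right_eq_mul]
      rw [e']
      split_ifs
      · rw [tensorElt_mul_tensorElt, if_pos e]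
      · simp
    · intro b _ hb
      have e : ¬ a = conjTuple x b := by
        rintro rfl
        exact hb (by simp [conjTuple, mul_assoc])
      split_ifs
      · rw [tensorElt_mul_tensorElt, if_neg e]
      all_goals simp
    · simp
  unfold tensorIntegral
  rw [Matrix.smul_mul, Matrix.mul_smul, Finset.sum_mul_sum]
  congr 1
  simp only [h1]
  have h2 : ∀ x : G, (∑ y : G, ∑ a, if tupleProd a = 1 then tensorElt ρ a (x * y) else 0) =
      ∑ y : G, ∑ a, if tupleProd a = 1 then tensorElt ρ a y else 0 := fun x =>
    Fintype.sum_equiv (Equiv.mulLeft x) _ _ fun y => rfl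
  rw [Finset.sum_congr rfl fun x _ => h2 x, Finset.sum_const, Finset.card_univ,
    ← Nat.cast_smul_eq_nsmul ℂ, smul_smul, inv_mul_cancel₀ hcard, one_smul]

/-- The cyclic shift of 5-tuples. -/
def rotateTuple (α : Type*) : Equiv.Perm (α × α × α × α × α) where
  toFun i := (i.2.1, i.2.2.1, i.2.2.2.1, i.2.2.2.2, i.1)
  invFun i := (i.2.2.2.2, i.1, i.2.1, i.2.2.1, i.2.2.2.1)
  left_inv _ := rfl
  right_inv _ := rfl

/-- The condition that the product of a tuple be 1 is invariant under cyclic rotation, since a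
rotated product is a conjugate of the original one. -/
theorem tensorIntegral_rotateTuple (ρ : DrinfeldDouble G →ₐ[ℂ] Matrix I I ℂ)
    (i j : I × I × I × I × I) :
    tensorIntegral ρ (rotateTuple I i) (rotateTuple I j) = tensorIntegral ρ i j := by
  classical
  unfold tensorIntegral
  simp only [Matrix.smul_apply, Matrix.sum_apply]
  congr 1
  refine Finset.sum_congr rfl fun x _ => ?_
  refine Fintype.sum_equiv (rotateTuple G).symm _ _ fun a => ?_
  have e : tupleProd ((rotateTuple G).symm a) = 1 ↔ tupleProd a = 1 := by
    obtain ⟨a0, a1, a2, a3, a4⟩ := a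
    change a4 * a0 * a1 * a2 * a3 = 1 ↔ a0 * a1 * a2 * a3 * a4 = 1
    rw [mul_eq_one_comm (a := a0 * a1 * a2 * a3), ← mul_assoc, ← mul_assoc, ← mul_assoc]
  simp only [e]
  split_ifs
  · simp only [tensorElt, rotateTuple, Matrix.kroneckerMap_apply, Equiv.coe_fn_mk,
      Equiv.coe_fn_symm_mk]
    ring
  · rfl

/-- Contracting a pure tensor along a 5-cycle gives the trace of the product of its factors, here in
decreasing order; the inverse cycle, the fourth power, gives increasing order. -/
theorem trace_tensorElt_rotate (ρ : DrinfeldDouble G →ₐ[ℂ] Matrix I I ℂ)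
    (a : G × G × G × G × G) (x : G) :
    ∑ i, tensorElt ρ a x (rotateTuple I i) i = (ρ (elt a.2.2.2.2 x * (elt a.2.2.2.1 x *
      (elt a.2.2.1 x * (elt a.2.1 x * elt a.1 x))))).trace := by
  simp only [← mul_assoc, map_mul, Matrix.trace, Matrix.diag_apply, Matrix.mul_apply,
    Finset.sum_mul, Fintype.sum_prod_type, tensorElt, rotateTuple, Matrix.kroneckerMap_apply,
    Equiv.coe_fn_mk]
  refine Finset.sum_congr rfl fun _ _ => Finset.sum_congr rfl fun _ _ =>
    Finset.sum_congr rfl fun _ _ => Finset.sum_congr rfl fun _ _ =>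
    Finset.sum_congr rfl fun _ _ => ?_
  ring

theorem trace_tensorElt_rotate_pow_four (ρ : DrinfeldDouble G →ₐ[ℂ] Matrix I I ℂ)
    (a : G × G × G × G × G) (x : G) :
    ∑ i, tensorElt ρ a x ((rotateTuple I ^ 4 : Equiv.Perm _) i) i = (ρ (elt a.2.1 x *
      (elt a.2.2.1 x * (elt a.2.2.2.1 x * (elt a.2.2.2.2 x * elt a.1 x))))).trace := by
  have h : ∀ i, (rotateTuple I ^ 4 : Equiv.Perm _) i =
      (i.2.2.2.2, i.1, i.2.1, i.2.2.1, i.2.2.2.1) := fun _ => rfl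
  simp only [h, map_mul, Matrix.trace, Matrix.diag_apply, Matrix.mul_apply, Finset.mul_sum,
    Fintype.sum_prod_type, tensorElt, Matrix.kroneckerMap_apply]
  refine Finset.sum_congr rfl fun _ _ => Finset.sum_congr rfl fun _ _ =>
    Finset.sum_congr rfl fun _ _ => Finset.sum_congr rfl fun _ _ =>
    Finset.sum_congr rfl fun _ _ => ?_
  ring

/-- The product of basis elements vanishes unless each entry is the x-conjugate of the preceding
one, so the last entry b parametrizes the tuples that contribute. -/
theorem sum_tuple_ite (L : DrinfeldDouble G →ₗ[ℂ] ℂ) (x : G) (Q : G × G × G × G × G → Prop)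
    [DecidablePred Q] :
    (∑ c : G × G × G × G × G, if Q c then L (elt c.2.2.2.2 x * (elt c.2.2.2.1 x *
      (elt c.2.2.1 x * (elt c.2.1 x * elt c.1 x)))) else 0) =
    ∑ b : G, if Q (x⁻¹ ^ 4 * b * x ^ 4, x⁻¹ ^ 3 * b * x ^ 3, x⁻¹ ^ 2 * b * x ^ 2, x⁻¹ * b * x, b)
      then L (elt b (x ^ 5)) else 0 := by
  classical
  have h : ∀ c0 c1 c2 c3 c4 : G, (if Q (c0, c1, c2, c3, c4) then L (elt c4 x * (elt c3 x *
      (elt c2 x * (elt c1 x * elt c0 x)))) else 0) =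
      if c1 = x * c0 * x⁻¹ then if c2 = x * c1 * x⁻¹ then if c3 = x * c2 * x⁻¹ then
        if c4 = x * c3 * x⁻¹ then if Q (c0, c1, c2, c3, c4) then L (elt c4 (x ^ 5)) else 0
        else 0 else 0 else 0 else 0 := by
    intro c0 c1 c2 c3 c4
    have e : x * (x * (x * (x * x))) = x ^ 5 := by simp [pow_succ, mul_assoc]
    simp only [elt_mul_elt, mul_ite, mul_zero, apply_ite L, map_zero, e]
    split_ifs <;> rfl
  simp only [Fintype.sum_prod_type, h, Finset.sum_ite_irrel, Finset.sum_const_zero,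
    Finset.sum_ite_eq', Finset.mem_univ, if_true]
  refine Fintype.sum_equiv (MulAut.conj (x ^ 4)).toEquiv _ _ fun b => ?_
  have e0 : (MulAut.conj (x ^ 4)).toEquiv b = x ^ 4 * b * (x ^ 4)⁻¹ := rfl
  rw [e0]
  have e1 : x⁻¹ ^ 4 * (x ^ 4 * b * (x ^ 4)⁻¹) * x ^ 4 = b := by group
  have e2 : x⁻¹ ^ 3 * (x ^ 4 * b * (x ^ 4)⁻¹) * x ^ 3 = x * b * x⁻¹ := by group
  have e3 : x⁻¹ ^ 2 * (x ^ 4 * b * (x ^ 4)⁻¹) * x ^ 2 =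
      x * (x * b * x⁻¹) * x⁻¹ := by simp [pow_succ, mul_assoc]
  have e4 : x⁻¹ * (x ^ 4 * b * (x ^ 4)⁻¹) * x =
      x * (x * (x * b * x⁻¹) * x⁻¹) * x⁻¹ := by simp [pow_succ, mul_assoc]
  have e5 : x ^ 4 * b * (x ^ 4)⁻¹ =
      x * (x * (x * (x * b * x⁻¹) * x⁻¹) * x⁻¹) * x⁻¹ := by simp [pow_succ, mul_assoc]
  rw [e1, e2, e3, e4, e5]

theorem trace_tensorIntegral_submatrix (ρ : DrinfeldDouble G →ₐ[ℂ] Matrix I I ℂ)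
    (s : I × I × I × I × I → I × I × I × I × I) [DecidableEq G] :
    ((tensorIntegral ρ).submatrix s id).trace = (Fintype.card G : ℂ)⁻¹ *
      ∑ x : G, ∑ a, if tupleProd a = 1 then ∑ i, tensorElt ρ a x (s i) i else 0 := by
  have : ∀ i, tensorIntegral ρ (s i) i = (Fintype.card G : ℂ)⁻¹ *
      ∑ x : G, ∑ a, if tupleProd a = 1 then tensorElt ρ a x (s i) i else 0 := by
    intro i
    unfold tensorIntegral
    rw [Matrix.smul_apply, smul_eq_mul, Matrix.sum_apply]
    congr 1
    refine Finset.sum_congr rfl fun x _ => ?_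
    rw [Matrix.sum_apply]
    refine Finset.sum_congr rfl fun a _ => ?_
    split_ifs <;> rfl
  simp only [Matrix.trace, Matrix.diag_apply, Matrix.submatrix_apply, id, this]
  rw [← Finset.mul_sum, Finset.sum_comm]
  congr 1
  refine Finset.sum_congr rfl fun x _ => ?_
  rw [Finset.sum_comm]
  refine Finset.sum_congr rfl fun a _ => ?_
  split_ifs <;> simp

open Classical in
theorem trace_tensorIntegral_rotate (ρ : DrinfeldDouble G →ₐ[ℂ] Matrix I I ℂ) :
    ((tensorIntegral ρ).submatrix (rotateTuple I) id).trace = (Fintype.card G : ℂ)⁻¹ *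
      ∑ x : G, ∑ a : G, if (x * a) ^ 5 = x ^ 5 then (ρ (elt a (x ^ 5))).trace else 0 := by
  rw [trace_tensorIntegral_submatrix]
  congr 1
  refine Finset.sum_congr rfl fun x _ => ?_
  simp only [trace_tensorElt_rotate]
  refine (sum_tuple_ite (Matrix.traceLinearMap I ℂ ℂ ∘ₗ ρ.toLinearMap) x
    (fun c => tupleProd c = 1)).trans ?_
  refine Finset.sum_congr rfl fun b _ => if_congr ?_ rfl rfl
  have e : tupleProd (x⁻¹ ^ 4 * b * x ^ 4, x⁻¹ ^ 3 * b * x ^ 3, x⁻¹ ^ 2 * b * x ^ 2,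
      x⁻¹ * b * x, b) = (x ^ 5)⁻¹ * (x * b) ^ 5 := by
    simp only [tupleProd, pow_succ, pow_zero]
    group
  rw [e, inv_mul_eq_one, eq_comm]

open Classical in
theorem trace_tensorIntegral_rotate_pow_four (ρ : DrinfeldDouble G →ₐ[ℂ] Matrix I I ℂ) :
    ((tensorIntegral ρ).submatrix (rotateTuple I ^ 4 : Equiv.Perm _) id).trace =
      (Fintype.card G : ℂ)⁻¹ * ∑ x : G, ∑ a : G,
        if (a * x⁻¹) ^ 5 * x ^ 5 = 1 then (ρ (elt a (x ^ 5))).trace else 0 := by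
  rw [trace_tensorIntegral_submatrix]
  congr 1
  refine Finset.sum_congr rfl fun x _ => ?_
  simp only [trace_tensorElt_rotate_pow_four]
  -- Reversing the last four entries turns the increasing order of factors into the decreasing one
  -- required by `sum_tuple_ite`.
  let r : G × G × G × G × G ≃ G × G × G × G × G :=
    { toFun := fun c => (c.1, c.2.2.2.2, c.2.2.2.1, c.2.2.1, c.2.1)
      invFun := fun c => (c.1, c.2.2.2.2, c.2.2.2.1, c.2.2.1, c.2.1)
      left_inv := fun _ => rfl
      right_inv := fun _ => rfl }
  rw [← Equiv.sum_comp r]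
  refine (sum_tuple_ite (Matrix.traceLinearMap I ℂ ℂ ∘ₗ ρ.toLinearMap) x
    (fun c => tupleProd (r c) = 1)).trans ?_
  refine Finset.sum_congr rfl fun b _ => if_congr ?_ rfl rfl
  have e : tupleProd (r (x⁻¹ ^ 4 * b * x ^ 4, x⁻¹ ^ 3 * b * x ^ 3, x⁻¹ ^ 2 * b * x ^ 2,
      x⁻¹ * b * x, b)) = x⁻¹ ^ 4 * b * x ^ 4 * ((b * x⁻¹) ^ 5 * x ^ 5) *
        (x⁻¹ ^ 4 * b * x ^ 4)⁻¹ := by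
    simp [tupleProd, r, pow_succ, mul_assoc]
  rw [e, mul_inv_eq_one, mul_eq_left]

-- The substitution x ↦ x a exchanges the two sums; on their support x⁵ = (x a)⁵, so the summands
-- agree. Consequently Pσ and Pσ⁴ have the same trace.
open Classical in
theorem sum_trace_eq_sum_trace (ρ : DrinfeldDouble G →ₐ[ℂ] Matrix I I ℂ) :
    (∑ x : G, ∑ a : G, if (x * a) ^ 5 = x ^ 5 then (ρ (elt a (x ^ 5))).trace else 0) =
    ∑ x : G, ∑ a : G,
        if (a * x⁻¹) ^ 5 * x ^ 5 = 1 then (ρ (elt a (x ^ 5))).trace else 0 := by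
  rw [Finset.sum_comm]
  conv_rhs => rw [Finset.sum_comm]
  refine Finset.sum_congr rfl fun a _ => ?_
  refine Fintype.sum_equiv (Equiv.mulRight a) _ _ fun x => ?_
  have e : a * (x * a)⁻¹ = x⁻¹ := by group
  simp only [Equiv.coe_mulRight, e, inv_pow, inv_mul_eq_one]
  by_cases h : (x * a) ^ 5 = x ^ 5
  · simp [h]
  · simp [h, Ne.symm h]


/-- The fifth indicator is a sum of fifth roots of unity, and equals the sum of their inverses. -/
theorem exists_fsIndicator_five_eq_sum (V : Type u) [AddCommGroup V] [Module ℂ V]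
    [Module (DrinfeldDouble G) V] [IsScalarTower ℂ (DrinfeldDouble G) V] [FiniteDimensional ℂ V]
    {ζ : ℂ} (hζ : IsPrimitiveRoot ζ 5) :
    ∃ c : ℕ → ℕ, fsIndicator G 5 V = ∑ k ∈ Finset.range 5, (c k : ℂ) * ζ ^ k ∧
      fsIndicator G 5 V = ∑ k ∈ Finset.range 5, (c k : ℂ) * ζ ^ (k * 4) := by
  classical
  let b := Module.finBasis ℂ V
  let ρ : DrinfeldDouble G →ₐ[ℂ] Matrix (Fin (Module.finrank ℂ V)) (Fin (Module.finrank ℂ V)) ℂ :=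
    (LinearMap.toMatrixAlgEquiv b).toAlgHom.comp (Algebra.lsmul ℂ ℂ V)
  have hρ : ∀ h, (ρ h).trace = character V h := fun h =>
    (LinearMap.trace_eq_matrix_trace ℂ b _).symm
  have h4 : fsIndicator G 5 V = ((tensorIntegral ρ).submatrix
      (rotateTuple _ ^ 4 : Equiv.Perm _) id).trace := by
    rw [trace_tensorIntegral_rotate_pow_four, fsIndicator_eq_sum]
    simp only [hρ]
  have h1 : fsIndicator G 5 V = ((tensorIntegral ρ).submatrix (rotateTuple _) id).trace := by
    rw [h4, trace_tensorIntegral_rotate_pow_four, trace_tensorIntegral_rotate,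
      sum_trace_eq_sum_trace]
  have hpow := Matrix.pow_submatrix_perm (tensorIntegral ρ) (tensorIntegral_mul_self ρ)
    (rotateTuple _) (tensorIntegral_rotateTuple ρ)
  obtain ⟨c, hc⟩ := Matrix.exists_trace_pow_eq_sum (n := 5) (by norm_num) hζ
    -- The hypothesis E⁶ = E holds because the sixth power of the rotation is the rotation itself.
    ((tensorIntegral ρ).submatrix (rotateTuple _) id) (by rw [hpow]; rfl)
  refine ⟨c, ?_, ?_⟩
  · rw [h1, ← pow_one (Matrix.submatrix _ _ _), hc 0 (by norm_num)]
    simp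
  · rw [h4, ← hpow 3, hc 3 (by norm_num)]

/-- The fifth indicator is an algebraic integer in `ℚ(√5)`. -/
theorem fsIndicator_five_isIntegral_and_mem (V : Type u) [AddCommGroup V] [Module ℂ V]
    [Module (DrinfeldDouble G) V] [IsScalarTower ℂ (DrinfeldDouble G) V]
    [FiniteDimensional ℂ V] :
    IsIntegral ℤ (fsIndicator G 5 V) ∧
      ∃ r t : ℚ, fsIndicator G 5 V = r + t * (Real.sqrt 5 : ℂ) := by
  obtain ⟨ζ, hζ⟩ : ∃ ζ : ℂ, IsPrimitiveRoot ζ 5 :=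
    ⟨_, Complex.isPrimitiveRoot_exp 5 (by norm_num)⟩
  obtain ⟨c, h1, h2⟩ := exists_fsIndicator_five_eq_sum (G := G) V hζ
  refine ⟨?_, ?_⟩
  · rw [h1]
    refine IsIntegral.sum _ fun k _ => ?_
    exact IsIntegral.mul (by simpa using isIntegral_algebraMap (R := ℤ) (A := ℂ) (x := (c k : ℤ)))
      ((hζ.isIntegral (by norm_num)).pow k)
  · simp only [Finset.sum_range_succ, Finset.sum_range_zero] at h1 h2
    have hg := hζ.geom_sum_eq_zero (by norm_num)
    simp only [Finset.sum_range_succ, Finset.sum_range_zero] at hg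
    have h5 := hζ.pow_eq_one
    have hs : ((Real.sqrt 5 : ℝ) : ℂ) ^ 2 = 5 := by
      rw [← Complex.ofReal_pow, Real.sq_sqrt (by norm_num)]
      norm_num
    -- The Gauss period α = ζ + ζ⁴ satisfies (2α + 1)² = 5. The sign of the root depends on ζ, hence
    -- the two cases below.
    have hα : (2 * (ζ + ζ ^ 4) + 1 - (Real.sqrt 5 : ℂ)) *
        (2 * (ζ + ζ ^ 4) + 1 + (Real.sqrt 5 : ℂ)) = 0 := by
      linear_combination 4 * hg + (8 + 4 * ζ ^ 3) * h5 - hs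
    -- The two expansions of ν are added, and ζ² + ζ³ = -1 - α.
    have hν : 2 * fsIndicator G 5 V = 2 * c 0 + (c 1 + c 4) * (ζ + ζ ^ 4) -
        (c 2 + c 3) * (1 + (ζ + ζ ^ 4)) := by
      linear_combination h1 + h2 + (c 2 + c 3) * hg +
        (c 2 * ζ ^ 3 + c 3 * (ζ ^ 2 * (ζ ^ 5 + 1)) + c 4 * (ζ * (1 + ζ ^ 5 + ζ ^ 10))) * h5
    rcases mul_eq_zero.1 hα with h | h
    · refine ⟨c 0 - (c 1 + c 4 + c 2 + c 3) / 4, (c 1 + c 4 - c 2 - c 3) / 4, ?_⟩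
      push_cast
      linear_combination hν / 2 + (c 1 + c 4 - c 2 - c 3) / 4 * h
    · refine ⟨c 0 - (c 1 + c 4 + c 2 + c 3) / 4, -(c 1 + c 4 - c 2 - c 3) / 4, ?_⟩
      push_cast
      linear_combination hν / 2 + (c 1 + c 4 - c 2 - c 3) / 4 * h

end DrinfeldDouble

theorem exists_int_of_isIntegral_of_rat {z : ℂ} (hz : IsIntegral ℤ z) {r : ℚ} (h : z = r) :
    ∃ m : ℤ, z = m := by
  subst h
  have h1 : IsIntegral ℤ r :=
    (isIntegral_algebraMap_iff (algebraMap ℚ ℂ).injective).1 (by simpa using hz)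
  obtain ⟨m, hm⟩ := IsIntegrallyClosed.isIntegral_iff.1 h1
  refine ⟨m, ?_⟩
  rw [← hm]
  simp

/-! ### Construction of M(a, b, x, y, w) on normal forms -/

/-- The carry cocycle of the extension `ℤ/5 → ℤ/25 → ℤ/5`. -/
def carry (s t : ZMod 5) : ZMod 5 := if s.val + t.val < 5 then 0 else 1

theorem carry_cocycle (r s t : ZMod 5) :
    carry r s + carry (r + s) t = carry s t + carry r (s + t) := by
  revert r s t; decide

/-- The elements `s₁^{i₁} ⋯ s₅^{i₅}` of the group `M(a, b, x, y, w)`. -/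
@[ext]
structure PcCore where
  c1 : ZMod 5
  c2 : ZMod 5
  c3 : ZMod 5
  c4 : ZMod 5
  c5 : ZMod 5

namespace PcCore

/-- Multiplication of normal forms. -/
def mul (b x y w : ZMod 5) (m n : PcCore) : PcCore where
  c1 := m.c1 + n.c1
  c2 := m.c2 + n.c2
  c3 := m.c3 + n.c3
  c4 := m.c4 + n.c4 + x * n.c1 * m.c2
  -- Modulo 5 the factor 3 is 1/2. Moving s₂ past s₁ⁿ creates n copies of s₄ˣ, which must still pass
  -- n - 1, n - 2, …, 0 further letters s₁; the total is the binomial coefficient n(n - 1)/2.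
  c5 := m.c5 + n.c5 + y * n.c1 * m.c2 + 3 * w * x * m.c2 * n.c1 * (n.c1 - 1) +
    (x + w) * n.c1 * m.c3 + w * n.c1 * m.c4 - w * m.c3 * n.c2 + b * carry m.c1 n.c1

/-- Conjugation of a normal form by `s₀ ^ k`. -/
def twist (x y w k : ZMod 5) (m : PcCore) : PcCore where
  c1 := m.c1
  c2 := k * m.c1 + m.c2
  c3 := 3 * k ^ 2 * m.c1 + 2 * k * m.c1 + k * m.c2 + m.c3
  c4 := k ^ 3 * m.c1 + 2 * k ^ 2 * m.c1 + 3 * k ^ 2 * m.c2 + 3 * k * m.c1 ^ 2 * x +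
    2 * k * m.c1 * x + 2 * k * m.c1 + 2 * k * m.c2 + k * m.c3 + m.c4
  c5 := 4 * k ^ 4 * m.c1 + 4 * k ^ 3 * m.c1 ^ 2 * w + k ^ 3 * m.c1 + k ^ 3 * m.c2 +
    4 * k ^ 2 * m.c1 ^ 2 * x + 4 * k ^ 2 * m.c1 ^ 2 * w + 2 * k ^ 2 * m.c1 * m.c2 * w +
    k ^ 2 * m.c1 * x + 4 * k ^ 2 * m.c1 * w + 4 * k ^ 2 * m.c1 + 2 * k ^ 2 * m.c2 +
    3 * k ^ 2 * m.c3 + k * m.c1 ^ 3 * x * w + 2 * k * m.c1 ^ 2 * x * w + k * m.c1 ^ 2 * x +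
    3 * k * m.c1 ^ 2 * y + 2 * k * m.c1 ^ 2 * w + 3 * k * m.c1 * m.c2 * w +
    2 * k * m.c1 * x * w + 4 * k * m.c1 * x + 2 * k * m.c1 * y + k * m.c1 * w + k * m.c1 +
    2 * k * m.c2 ^ 2 * w + 3 * k * m.c2 * w + 2 * k * m.c2 + 2 * k * m.c3 + k * m.c4 + m.c5

/-- Multiplication by the central element `s₅ ^ t`. -/
def shift (t : ZMod 5) (m : PcCore) : PcCore := { m with c5 := m.c5 + t }

theorem mul_assoc' (b x y w : ZMod 5) (m n p : PcCore) :
    mul b x y w (mul b x y w m n) p = mul b x y w m (mul b x y w n p) := by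
  have h := carry_cocycle m.c1 n.c1 p.c1
  ext <;> simp only [mul]
  · ring
  · ring
  · ring
  · ring
  · rw [← sub_eq_zero]
    -- Apart from the carries, associativity is a polynomial identity over ℤ/5; the carries enter
    -- only through their cocycle identity.
    trans b * ((carry m.c1 n.c1 + carry (m.c1 + n.c1) p.c1) -
      (carry n.c1 p.c1 + carry m.c1 (n.c1 + p.c1)))
    · ring_nf
      reduce_mod_char
    · rw [h, sub_self, mul_zero]

theorem twist_mul (b x y w k : ZMod 5) (m n : PcCore) :
    twist x y w k (mul b x y w m n) = mul b x y w (twist x y w k m) (twist x y w k n) := by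
  ext <;> simp only [mul, twist] <;> rw [← sub_eq_zero] <;> ring_nf <;> reduce_mod_char

theorem twist_twist (x y w k l : ZMod 5) (m : PcCore) :
    twist x y w k (twist x y w l m) = twist x y w (l + k) m := by
  ext <;> simp only [twist] <;> rw [← sub_eq_zero] <;> ring_nf <;> reduce_mod_char

end PcCore

namespace PcCore

theorem shift_mul (b x y w t : ZMod 5) (m n : PcCore) :
    mul b x y w (shift t m) n = shift t (mul b x y w m n) := by
  ext <;> simp only [mul, shift]
  ring

theorem mul_shift (b x y w t : ZMod 5) (m n : PcCore) :
    mul b x y w m (shift t n) = shift t (mul b x y w m n) := by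
  ext <;> simp only [mul, shift]
  ring

theorem twist_shift (x y w k t : ZMod 5) (m : PcCore) :
    twist x y w k (shift t m) = shift t (twist x y w k m) := by
  ext <;> simp only [twist, shift]
  ring

theorem shift_shift (s t : ZMod 5) (m : PcCore) : shift s (shift t m) = shift (t + s) m := by
  ext <;> simp only [shift]
  ring

end PcCore

/-- The group `M(a, b, x, y, w)`, realized on the normal forms `s₀^{i₀} ⋯ s₅^{i₅}`. -/
@[ext]
structure PcGroup (a b x y w : ZMod 5) where
  c0 : ZMod 5
  core : PcCore

namespace PcGroup

open PcCore

variable {a b x y w : ZMod 5}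

instance : Mul (PcGroup a b x y w) :=
  ⟨fun g h => ⟨g.c0 + h.c0, shift (a * carry g.c0 h.c0)
    (PcCore.mul b x y w (twist x y w h.c0 g.core) h.core)⟩⟩

instance : One (PcGroup a b x y w) := ⟨⟨0, ⟨0, 0, 0, 0, 0⟩⟩⟩

theorem one_def : (1 : PcGroup a b x y w) = ⟨0, ⟨0, 0, 0, 0, 0⟩⟩ := rfl

theorem mul_def (g h : PcGroup a b x y w) : g * h = ⟨g.c0 + h.c0, shift (a * carry g.c0 h.c0)
    (PcCore.mul b x y w (twist x y w h.c0 g.core) h.core)⟩ := rfl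

theorem carry_zero_left (t : ZMod 5) : carry 0 t = 0 := by revert t; decide

theorem carry_zero_right (t : ZMod 5) : carry t 0 = 0 := by revert t; decide

instance : Monoid (PcGroup a b x y w) where
  mul_assoc g h k := by
    simp only [mul_def]
    ext1
    · exact add_assoc _ _ _
    · simp only [twist_shift, twist_mul, twist_twist, shift_mul, mul_shift, mul_assoc',
        shift_shift, ← mul_add]
      rw [carry_cocycle]
  one_mul g := by
    simp only [mul_def, one_def]
    ext <;> simp [shift, PcCore.mul, twist, carry_zero_left]
  mul_one g := by
    simp only [mul_def, one_def]
    ext <;> simp [shift, PcCore.mul, twist, carry_zero_right]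

/-- The exponent of `s₅` in the fifth power of an element. -/
def fifthPower (a b w i j : ZMod 5) : ZMod 5 := a * i + b * j + i ^ 4 * j + 3 * w * i ^ 3 * j ^ 2

/-- Adding t to itself five times in ℤ/5 produces t carries in all, since 5t is t fives. Thus s₀⁵ =
s₅ᵃ and s₁⁵ = s₅ᵇ contribute the linear part ai + bj of the fifth power map. -/
theorem carry_sum (t : ZMod 5) :
    2 * carry t t + carry (t + t) (t + t) + carry (t + t + (t + t)) t = t := by
  revert t; decide

theorem pow_five (g : PcGroup a b x y w) :
    g ^ 5 = ⟨0, ⟨0, 0, 0, 0, fifthPower a b w g.c0 g.core.c1⟩⟩ := by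
  obtain ⟨k, ⟨i1, i2, i3, i4, i5⟩⟩ := g
  have e : ∀ g : PcGroup a b x y w, g ^ 5 = (g * g) * (g * g) * g := fun g => by
    simp [pow_succ, mul_assoc]
  rw [e]
  have h0 := carry_sum k
  have h1 := carry_sum i1
  simp only [mul_def, shift, PcCore.mul, twist, fifthPower]
  ext <;> simp only
  · ring_nf; reduce_mod_char
  · ring_nf; reduce_mod_char
  · ring_nf; reduce_mod_char
  · ring_nf; reduce_mod_char
  · ring_nf; reduce_mod_char
  · generalize carry k k = A1 at *
    generalize carry (k + k) (k + k) = A2 at *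
    generalize carry (k + k + (k + k)) k = A3 at *
    generalize carry i1 i1 = B1 at *
    generalize carry (i1 + i1) (i1 + i1) = B2 at *
    generalize carry (i1 + i1 + (i1 + i1)) i1 = B3 at *
    rw [← sub_eq_zero]
    trans a * (2 * A1 + A2 + A3 - k) + b * (2 * B1 + B2 + B3 - i1)
    · rw [← sub_eq_zero]
      ring_nf
      reduce_mod_char
    · rw [h0, h1]
      ring

end PcGroup

/-! ### The fifth power map: exponent, irregularity, non-integrality -/

namespace PcGroup

/-- The number of pairs `(i, j)` with `f(i, j) = f(i + k, j + l) = t`, where `f` is the fifth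
power map. -/
def pairCount (a b w k l t : ZMod 5) : ℕ :=
  (Finset.univ.filter fun p : ZMod 5 × ZMod 5 =>
    fifthPower a b w p.1 p.2 = t ∧ fifthPower a b w (k + p.1) (l + p.2) = t).card

-- A finite check over the 125 triples (a, b, w). The hypothesis is the right one: if w = 0 and
-- either b = 0 or (a, b) = (0, -1), the count is independent of t ≠ 0 for every shift.
set_option maxRecDepth 100000 in
theorem exists_pairCount_ne (a b w : ZMod 5) (h : w ≠ 0 ∨ (b ≠ 0 ∧ ¬ (a = 0 ∧ b = -1))) :
    ∃ u ∈ [((1 : ZMod 5), (0 : ZMod 5)), (0, 1), (1, 1)], ∃ t ∈ [2, 3, 4],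
      pairCount a b w u.1 u.2 ((1 : ℕ) : ZMod 5) ≠ pairCount a b w u.1 u.2 ((t : ℕ) : ZMod 5) := by
  revert a b w
  decide +kernel

/-- The defect of additivity at (1, j) is j(1 + 3wj), which cannot vanish at both j = 1 and j = -1.
-/
theorem exists_fifthPower_ne_add (a b w : ZMod 5) : ∃ j : ZMod 5,
    fifthPower a b w 1 j ≠ fifthPower a b w 1 0 + fifthPower a b w 0 j := by
  by_cases h : 1 + 3 * w = 0
  · refine ⟨-1, fun h1 => ?_⟩
    have h2 : (2 : ZMod 5) = 0 := by
      simp only [fifthPower] at h1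
      linear_combination h - h1
    exact absurd h2 (by decide)
  · refine ⟨1, fun h1 => h ?_⟩
    simp only [fifthPower] at h1
    linear_combination h1

open PcCore

variable {a b x y w : ZMod 5}

/-- The central element `s₅ ^ t`. -/
def central (a b x y w : ZMod 5) : Multiplicative (ZMod 5) →* PcGroup a b x y w where
  toFun t := ⟨0, ⟨0, 0, 0, 0, t.toAdd⟩⟩
  map_one' := rfl
  map_mul' _ _ := by
    simp only [mul_def, carry_zero_left]
    ext <;> simp [shift, PcCore.mul, twist, carry_zero_left]

theorem central_mul (t : Multiplicative (ZMod 5)) (g : PcGroup a b x y w) :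
    central a b x y w t * g = g * central a b x y w t := by
  simp only [mul_def, central, MonoidHom.coe_mk, OneHom.coe_mk, carry_zero_left,
    carry_zero_right]
  ext <;> simp [shift, PcCore.mul, twist, carry_zero_left, carry_zero_right, add_comm]

theorem central_injective : Function.Injective (central a b x y w) := fun _ _ h =>
  congrArg (fun g => g.core.c5) h

theorem pow_five' (g : PcGroup a b x y w) : g ^ 5 =
    central a b x y w (Multiplicative.ofAdd (fifthPower a b w g.c0 g.core.c1)) := pow_five g

theorem pow_twentyfive (g : PcGroup a b x y w) : g ^ 25 = 1 := by
  rw [show 25 = 5 * 5 from rfl, pow_mul, pow_five (g ^ 5), pow_five g, one_def]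
  simp [fifthPower]

instance : Group (PcGroup a b x y w) where
  -- The monoid already satisfies g²⁵ = 1, so no formula for inverses of normal forms is needed.
  inv g := g ^ 24
  inv_mul_cancel g := by
    change g ^ 24 * g = 1
    rw [← pow_succ, pow_twentyfive]

/-- The coordinates of a normal form. -/
def coordEquiv : PcGroup a b x y w ≃
    (ZMod 5 × ZMod 5) × (ZMod 5 × ZMod 5 × ZMod 5 × ZMod 5) where
  toFun g := ((g.c0, g.core.c1), (g.core.c2, g.core.c3, g.core.c4, g.core.c5))
  invFun p := ⟨p.1.1, ⟨p.1.2, p.2.1, p.2.2.1, p.2.2.2.1, p.2.2.2.2⟩⟩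
  left_inv _ := rfl
  right_inv _ := rfl

instance : Fintype (PcGroup a b x y w) := Fintype.ofEquiv _ coordEquiv.symm

theorem natCard : Nat.card (PcGroup a b x y w) = 5 ^ 6 := by
  rw [Nat.card_congr coordEquiv]
  simp

theorem exponent_eq : Monoid.exponent (PcGroup a b x y w) = 25 := by
  have h1 : Monoid.exponent (PcGroup a b x y w) ∣ 5 ^ 2 :=
    Monoid.exponent_dvd_of_forall_pow_eq_one pow_twentyfive
  have h2 : ¬ Monoid.exponent (PcGroup a b x y w) ∣ 5 := by
    intro h
    have h0 : ∀ i j : ZMod 5, fifthPower a b w i j = 0 := by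
      intro i j
      have := Monoid.exponent_dvd_iff_forall_pow_eq_one.1 h
        (⟨i, ⟨j, 0, 0, 0, 0⟩⟩ : PcGroup a b x y w)
      rw [pow_five, one_def] at this
      exact congrArg (fun g => g.core.c5) this
    obtain ⟨j, hj⟩ := exists_fifthPower_ne_add a b w
    exact hj (by simp [h0])
  obtain ⟨k, hk, hk'⟩ := (Nat.dvd_prime_pow Nat.prime_five).1 h1
  interval_cases k
  · exact absurd (hk' ▸ by norm_num) h2
  · exact absurd (hk' ▸ by norm_num) h2
  · exact hk'

theorem isPGroup : IsPGroup 5 (PcGroup a b x y w) := IsPGroup.of_card natCard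

/-- The abelianization map onto `(ℤ/5)²`. -/
def toAb : PcGroup a b x y w →* Multiplicative (ZMod 5 × ZMod 5) where
  toFun g := Multiplicative.ofAdd (g.c0, g.core.c1)
  map_one' := rfl
  map_mul' _ _ := rfl

theorem pow_five_of_mem_commutator {c : PcGroup a b x y w} (hc : c ∈ commutator _) :
    c ^ 5 = 1 := by
  have h : toAb c = 1 := Abelianization.commutator_subset_ker toAb hc
  have h' : (c.c0, c.core.c1) = ((0, 0) : ZMod 5 × ZMod 5) := h
  rw [Prod.mk.injEq] at h'
  rw [pow_five, h'.1, h'.2, one_def]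
  simp [fifthPower]

theorem not_isRegularPGroup : ¬ IsRegularPGroup 5 (PcGroup a b x y w) := by
  rintro ⟨-, h⟩
  obtain ⟨j, hj⟩ := exists_fifthPower_ne_add a b w
  -- Regularity is tested on s₀ and s₁ʲ with q = 5. The commutator factors have trivial fifth power,
  -- so it would make f additive on this pair.
  obtain ⟨L, hL, h⟩ := h ⟨1, ⟨0, 0, 0, 0, 0⟩⟩ ⟨0, ⟨j, 0, 0, 0, 0⟩⟩ 1
  have hprod : (L.map fun c => c ^ 5 ^ 1).prod = 1 := by
    refine List.prod_eq_one fun d hd => ?_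
    obtain ⟨c, hc, rfl⟩ := List.mem_map.1 hd
    rw [pow_one]
    exact pow_five_of_mem_commutator (Subgroup.commutator_mono le_top le_top (hL c hc))
  rw [hprod, mul_one, pow_one, pow_five', pow_five', pow_five', ← map_mul, ← ofAdd_add] at h
  have h2 := Multiplicative.ofAdd.injective (central_injective h)
  refine hj ?_
  simpa [mul_def, shift, PcCore.mul, twist] using h2

/-- Fifth powers see only the first two coordinates, which add under multiplication. The other four
are free and give 5⁴ = 625. -/
theorem powPairCount_central (k l t : ZMod 5) :
    DrinfeldDouble.powPairCount 5 (⟨k, ⟨l, 0, 0, 0, 0⟩⟩ : PcGroup a b x y w)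
      (central a b x y w (Multiplicative.ofAdd t)) = pairCount a b w k l t * 625 := by
  classical
  have hcard : Fintype.card (ZMod 5 × ZMod 5 × ZMod 5 × ZMod 5) = 625 := by
    simp [ZMod.card]
  rw [DrinfeldDouble.powPairCount, pairCount, ← hcard, ← Finset.card_univ,
    ← Finset.card_product]
  refine Finset.card_equiv coordEquiv fun g => ?_
  simp only [Finset.mem_filter, Finset.mem_univ, true_and, pow_five', central_injective.eq_iff,
    Finset.mem_product, and_true, Multiplicative.ofAdd.injective.eq_iff]
  rfl

theorem not_isFSZn (h : w ≠ 0 ∨ (b ≠ 0 ∧ ¬ (a = 0 ∧ b = -1))) :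
    ¬ IsFSZn 5 (PcGroup a b x y w) := by
  intro hG
  have : Fact (Nat.Prime 5) := ⟨Nat.prime_five⟩
  obtain ⟨⟨k, l⟩, -, t, ht, hne⟩ := exists_pairCount_ne a b w h
  obtain ⟨ζ, hζ⟩ : ∃ ζ : ℂ, IsPrimitiveRoot ζ 5 :=
    ⟨_, Complex.isPrimitiveRoot_exp 5 (by norm_num)⟩
  obtain ⟨m, hm⟩ := DrinfeldDouble.exists_int_sum_powPairCount_of_isFSZn hG
    (central a b x y w) central_mul (AddChar.zmodChar 5 hζ.pow_eq_one).toMonoidHom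
    ⟨k, ⟨l, 0, 0, 0, 0⟩⟩
  have hm' : ∑ s ∈ Finset.range 5, ((pairCount a b w k l (s : ZMod 5) * 625 : ℕ) : ℂ) * ζ ^ s =
      m := by
    have hsum : ∀ f : ℕ → ℂ, ∑ s ∈ Finset.range 5, f s = ∑ s : ZMod 5, f s.val :=
      fun f => (Fin.sum_univ_eq_sum_range f 5).symm
    rw [← hm, ← Equiv.sum_comp Multiplicative.ofAdd, hsum]
    refine Finset.sum_congr rfl fun s _ => ?_
    rw [powPairCount_central, mul_comm, ZMod.natCast_zmod_val]
    rfl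
  have hc := hζ.eq_of_sum_mul_pow_eq_zero
    -- The integer value m is absorbed into the constant coefficient, so the equality of
    -- coefficients compares the counts only at t ≠ 0.
    (fun s => (pairCount a b w k l (s : ZMod 5) * 625 : ℕ) - if s = 0 then m else 0) (by
      simp only [Int.cast_sub, Int.cast_natCast, sub_mul, Finset.sum_sub_distrib, hm']
      simp)
  have h1 := hc 1 (by norm_num)
  have ht5 : t < 5 ∧ t ≠ 0 := by
    simp only [List.mem_cons, List.not_mem_nil, or_false] at ht
    omega
  have h2 := hc t ht5.1
  rw [← h1] at h2
  simp only [if_neg ht5.2, one_ne_zero, if_false, sub_zero, Nat.cast_inj] at h2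
  exact hne (Nat.eq_of_mul_eq_mul_right (by norm_num) h2).symm

end PcGroup

/-! ### The generators and their power-commutator relations -/

namespace PcGroup

open PcCore

variable {a b x y w : ZMod 5}

/-- The generators `s₀, …, s₅`. -/
def gens (a b x y w : ZMod 5) : Fin 6 → PcGroup a b x y w :=
  ![⟨1, ⟨0, 0, 0, 0, 0⟩⟩, ⟨0, ⟨1, 0, 0, 0, 0⟩⟩, ⟨0, ⟨0, 1, 0, 0, 0⟩⟩, ⟨0, ⟨0, 0, 1, 0, 0⟩⟩,
    ⟨0, ⟨0, 0, 0, 1, 0⟩⟩, ⟨0, ⟨0, 0, 0, 0, 1⟩⟩]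

theorem s0_pow (n : ℕ) :
    ∃ t, gens a b x y w 0 ^ n = (⟨n, ⟨0, 0, 0, 0, t⟩⟩ : PcGroup a b x y w) := by
  induction n with
  | zero => exact ⟨0, by simp [one_def]⟩
  | succ n ih =>
    obtain ⟨t, ht⟩ := ih
    refine ⟨t + a * carry n 1, ?_⟩
    rw [pow_succ, ht, mul_def]
    ext <;> simp [gens, shift, PcCore.mul, twist, carry_zero_left]

theorem s1_pow (n : ℕ) :
    ∃ t, gens a b x y w 1 ^ n = (⟨0, ⟨n, 0, 0, 0, t⟩⟩ : PcGroup a b x y w) := by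
  induction n with
  | zero => exact ⟨0, by simp [one_def]⟩
  | succ n ih =>
    obtain ⟨t, ht⟩ := ih
    refine ⟨t + b * carry n 1, ?_⟩
    rw [pow_succ, ht, mul_def]
    ext <;> simp [gens, shift, PcCore.mul, twist, carry_zero_left]

theorem s2_pow (n : ℕ) :
    gens a b x y w 2 ^ n = (⟨0, ⟨0, n, 0, 0, 0⟩⟩ : PcGroup a b x y w) := by
  induction n with
  | zero => simp [one_def]
  | succ n ih =>
    rw [pow_succ, ih, mul_def]
    ext <;> simp [gens, shift, PcCore.mul, twist, carry_zero_left]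

theorem s3_pow (n : ℕ) :
    gens a b x y w 3 ^ n = (⟨0, ⟨0, 0, n, 0, 0⟩⟩ : PcGroup a b x y w) := by
  induction n with
  | zero => simp [one_def]
  | succ n ih =>
    rw [pow_succ, ih, mul_def]
    ext <;> simp [gens, shift, PcCore.mul, twist, carry_zero_left]

theorem s4_pow (n : ℕ) :
    gens a b x y w 4 ^ n = (⟨0, ⟨0, 0, 0, n, 0⟩⟩ : PcGroup a b x y w) := by
  induction n with
  | zero => simp [one_def]
  | succ n ih =>
    rw [pow_succ, ih, mul_def]
    ext <;> simp [gens, shift, PcCore.mul, twist, carry_zero_left]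

theorem s5_pow (n : ℕ) :
    gens a b x y w 5 ^ n = (⟨0, ⟨0, 0, 0, 0, n⟩⟩ : PcGroup a b x y w) := by
  induction n with
  | zero => simp [one_def]
  | succ n ih =>
    rw [pow_succ, ih, mul_def]
    ext <;> simp [gens, shift, PcCore.mul, twist, carry_zero_left]

/-- A normal form is built from its last letter backwards, so each multiplication on the left is
already in order and no commutators need collecting. -/
theorem closure_gens : Subgroup.closure (Set.range (gens a b x y w)) = ⊤ := by
  set S := Subgroup.closure (Set.range (gens a b x y w)) with hS
  have hmem : ∀ (k : Fin 6) (n : ℕ), gens a b x y w k ^ n ∈ S := fun k n =>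
    S.pow_mem (Subgroup.subset_closure ⟨k, rfl⟩) n
  have h5 : ∀ i5, (⟨0, ⟨0, 0, 0, 0, i5⟩⟩ : PcGroup a b x y w) ∈ S := fun i5 => by
    have := hmem 5 i5.val
    rwa [s5_pow, ZMod.natCast_zmod_val] at this
  have h4 : ∀ i4 i5, (⟨0, ⟨0, 0, 0, i4, i5⟩⟩ : PcGroup a b x y w) ∈ S := fun i4 i5 => by
    have := S.mul_mem (hmem 4 i4.val) (h5 i5)
    rw [s4_pow, ZMod.natCast_zmod_val] at this
    convert this using 1
    rw [mul_def]
    ext <;> simp [shift, PcCore.mul, twist, carry_zero_left]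
  have h3 : ∀ i3 i4 i5, (⟨0, ⟨0, 0, i3, i4, i5⟩⟩ : PcGroup a b x y w) ∈ S := fun i3 i4 i5 => by
    have := S.mul_mem (hmem 3 i3.val) (h4 i4 i5)
    rw [s3_pow, ZMod.natCast_zmod_val] at this
    convert this using 1
    rw [mul_def]
    ext <;> simp [shift, PcCore.mul, twist, carry_zero_left]
  have h2 : ∀ i2 i3 i4 i5, (⟨0, ⟨0, i2, i3, i4, i5⟩⟩ : PcGroup a b x y w) ∈ S :=
    fun i2 i3 i4 i5 => by
    have := S.mul_mem (hmem 2 i2.val) (h3 i3 i4 i5)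
    rw [s2_pow, ZMod.natCast_zmod_val] at this
    convert this using 1
    rw [mul_def]
    ext <;> simp [shift, PcCore.mul, twist, carry_zero_left]
  have h1 : ∀ i1 i2 i3 i4 i5, (⟨0, ⟨i1, i2, i3, i4, i5⟩⟩ : PcGroup a b x y w) ∈ S :=
    fun i1 i2 i3 i4 i5 => by
    obtain ⟨t, ht⟩ := s1_pow (a := a) (b := b) (x := x) (y := y) (w := w) i1.val
    -- The power of s₁ may carry a central factor s₅ᵗ from the carry terms; the shift i₅ - t
    -- compensates for it.
    have := S.mul_mem (hmem 1 i1.val) (h2 i2 i3 i4 (i5 - t))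
    rw [ht, ZMod.natCast_zmod_val] at this
    convert this using 1
    rw [mul_def]
    ext <;> simp [shift, PcCore.mul, twist, carry_zero_right]
  rw [eq_top_iff]
  rintro ⟨i0, ⟨i1, i2, i3, i4, i5⟩⟩ -
  obtain ⟨t, ht⟩ := s0_pow (a := a) (b := b) (x := x) (y := y) (w := w) i0.val
  have := S.mul_mem (hmem 0 i0.val) (h1 i1 i2 i3 i4 (i5 - t))
  rw [ht, ZMod.natCast_zmod_val] at this
  convert this using 1
  rw [mul_def]
  ext <;> simp [shift, PcCore.mul, twist, carry_zero_left, carry_zero_right]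

theorem isPcPresented_gens : IsPcPresented a b x y w (gens a b x y w) where
  gen := closure_gens
  pow0 := by
    rw [pow_five, s5_pow, ZMod.natCast_zmod_val]
    simp [gens, fifthPower]
  pow1 := by
    rw [pow_five, s5_pow, ZMod.natCast_zmod_val]
    simp [gens, fifthPower]
  pow2 := by rw [pow_five, one_def]; simp [gens, fifthPower]
  pow3 := by rw [pow_five, one_def]; simp [gens, fifthPower]
  pow4 := by rw [pow_five, one_def]; simp [gens, fifthPower]
  pow5 := by rw [pow_five, one_def]; simp [gens, fifthPower]
  rel10 := by
    simp only [mul_def]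
    ext <;> simp [gens, shift, PcCore.mul, twist, carry_zero_left, carry_zero_right] <;> ring_nf <;>
      reduce_mod_char
  rel20 := by
    simp only [mul_def]
    ext <;> simp [gens, shift, PcCore.mul, twist, carry_zero_left, carry_zero_right] <;> ring_nf <;>
      reduce_mod_char
  rel30 := by
    simp only [mul_def]
    ext <;> simp [gens, shift, PcCore.mul, twist, carry_zero_left, carry_zero_right]
    ring_nf
    reduce_mod_char
  rel40 := by
    simp only [mul_def]
    ext <;> simp [gens, shift, PcCore.mul, twist, carry_zero_left, carry_zero_right]
  rel21 := by
    rw [s4_pow, s5_pow, ZMod.natCast_zmod_val, ZMod.natCast_zmod_val]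
    simp only [mul_def]
    ext <;> simp [gens, shift, PcCore.mul, twist, carry_zero_left, carry_zero_right]
  rel31 := by
    rw [s5_pow, ZMod.natCast_zmod_val]
    simp only [mul_def]
    ext <;> simp [gens, shift, PcCore.mul, twist, carry_zero_left, carry_zero_right]
  rel41 := by
    rw [s5_pow, ZMod.natCast_zmod_val]
    simp only [mul_def]
    ext <;> simp [gens, shift, PcCore.mul, twist, carry_zero_left, carry_zero_right]
  rel32 := by
    rw [s5_pow, ZMod.natCast_zmod_val]
    simp only [mul_def]
    ext <;> simp [gens, shift, PcCore.mul, twist, carry_zero_right]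
  rel42 := by
    simp only [mul_def]
    ext <;> simp [gens, shift, PcCore.mul, twist, carry_zero_right]
  rel43 := by
    simp only [mul_def]
    ext <;> simp [gens, shift, PcCore.mul, twist, carry_zero_right]
  rel5 k := central_mul (Multiplicative.ofAdd 1) (gens a b x y w k)

end PcGroup

/-! ### The main theorem -/

theorem mainTheorem12 :
    -- irregular groups of order `5 ^ 6` and exponent `25` with a non-integral `ν_5`
    (∀ a b x y w : ZMod 5, (w ≠ 0 ∨ (b ≠ 0 ∧ ¬ (a = 0 ∧ b = -1))) →
      ∃ (G : Type) (_ : Group G) (_ : Fintype G),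
        Nat.card G = 5 ^ 6 ∧ (∃ s : Fin 6 → G, IsPcPresented a b x y w s) ∧
        Monoid.exponent G = 25 ∧ IsIrregularPGroup 5 G ∧ ¬ IsFSZn 5 G) ∧
    -- the non-integral `ν_5` are algebraic integers in `ℚ(√5) \ ℚ`
    (∀ (G : Type) [Group G] [Fintype G], Nat.card G = 5 ^ 6 → Monoid.exponent G = 25 →
      ∀ (V : Type) [AddCommGroup V] [Module ℂ V] [Module (DrinfeldDouble G) V]
        [IsScalarTower ℂ (DrinfeldDouble G) V] [FiniteDimensional ℂ V]
        [IsSimpleModule (DrinfeldDouble G) V],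
        (¬ ∃ m : ℤ, fsIndicator G 5 V = m) →
          IsIntegral ℤ (fsIndicator G 5 V) ∧
          (∃ r t : ℚ, fsIndicator G 5 V = r + t * (Real.sqrt 5 : ℂ)) ∧
          ¬ ∃ r : ℚ, fsIndicator G 5 V = r) ∧
    -- a direct product with a non-`FSZ` factor is not `FSZ`
    (∀ (F H : Type) [Group F] [Fintype F] [Group H] [Fintype H],
      ¬ IsFSZ F → ¬ IsFSZ (F × H)) ∧
    -- there are non-`FSZ` groups of infinitely many orders
    {N : ℕ | ∃ (G : Type) (_ : Group G) (_ : Fintype G), Nat.card G = N ∧ ¬ IsFSZ G}.Infinite := by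
  refine ⟨?_, ?_, ?_, ?_⟩
  · intro a b x y w h
    exact ⟨PcGroup a b x y w, inferInstance, inferInstance, PcGroup.natCard,
      ⟨_, PcGroup.isPcPresented_gens⟩, PcGroup.exponent_eq,
      ⟨PcGroup.isPGroup, PcGroup.not_isRegularPGroup⟩, PcGroup.not_isFSZn h⟩
  · intro G _ _ _ _ V _ _ _ _ _ _ hV
    obtain ⟨h1, h2⟩ := DrinfeldDouble.fsIndicator_five_isIntegral_and_mem (G := G) V
    exact ⟨h1, h2, fun ⟨_, hr⟩ => hV (exists_int_of_isIntegral_of_rat h1 hr)⟩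
  · intro F H _ _ _ _ hF h
    exact hF fun n hn => DrinfeldDouble.isFSZn_of_isFSZn_prod (h n hn)
  -- These are the orders of M(0, 0, 0, 0, 1) × ℤ/(n + 1); the shift by one keeps the cyclic factor
  -- finite.
  · refine Set.infinite_of_injective_forall_mem (f := fun n : ℕ => 5 ^ 6 * (n + 1)) ?_ ?_
    · intro m n hmn
      have : 5 ^ 6 * (m + 1) = 5 ^ 6 * (n + 1) := hmn
      omega
    · intro n
      refine ⟨PcGroup 0 0 0 0 1 × Multiplicative (ZMod (n + 1)), inferInstance, inferInstance,
        ?_, fun h => ?_⟩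
      · rw [Nat.card_prod, PcGroup.natCard, Nat.card_congr Multiplicative.toAdd, Nat.card_zmod]
      · exact PcGroup.not_isFSZn (a := 0) (b := 0) (w := 1) (Or.inl (by decide))
          (DrinfeldDouble.isFSZn_of_isFSZn_prod (h 5 (by norm_num)))
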